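/- Let $\mathbb{K}\in\{\mathbb{R},\mathbb{C}\}$, let $(X,\|\cdot\|)$ be a Banach space over $\mathbb{K}$ with norm dual $X'$, and let $\tau$ be a Hausdorff locally convex topology on $X$, coarser than the $\|\cdot\|$-topology, such that every $\|\cdot\|$-bounded $\tau$-Cauchy sequence is $\tau$-convergent and $(X,\tau)'$ is norming, i.e. $\|x\|=\sup\{|y(x)| : y\in (X,\tau)',\ \|y\|_{X'}\le 1\}$ for all $x\in X$. Let $$X^\circ:=\{x'\in X' : x' \text{ is } \tau\text{-sequentially continuous on } \|\cdot\|\text{-bounded sets}\}$$ and assume that $\{x^\circ\in X^\circ:\|x^\circ\|_{X'}\le 1\}$ is sequentially complete with respect to $\sigma(X^\circ,X)$ and that every $\|\cdot\|_{X'}$-bounded $\sigma(X^\circ,X)$-null sequence in $X^\circ$ is $\tau$-equicontinuous on $\|\cdot\|$-bounded sets. Let $\gamma$ be the mixed topology of $\|\cdot\|$ and $\tau$, i.e. the finest linear topology on $X$ that coincides with $\tau$ on $\|\cdot\|$-bounded sets and satisfies $\tau\le\gamma\le\tau_{\|\cdot\|}$. Let $(T(t))_{t\ge 0}$ be a $\tau$-bi-continuous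 semigroup on $X$: bounded linear operators with $T(0)=\mathrm{id}$ and $T(t+s)=T(t)T(s)$, such that $t\mapsto T(t)x$ is $\tau$-continuous on $[0,\infty)$ for every $x\in X$, $\|T(t)\|\le Me^{\omega t}$ for all $t\ge0$ with some $M\ge 1$, $\omega\in\mathbb{R}$, and for every $\|\cdot\|$-bounded sequence $(x_n)$ that $\tau$-converges to some $x\in X$ one has $T(t)(x_n-x)\to 0$ in $\tau$, locally uniformly in $t\in[0,\infty)$. Let $\omega_0(T)\in[-\infty,\infty)$ be the infimum of all $\omega\in\mathbb{R}$ for which there is $M\ge 1$ with $\|T(t)\|\le Me^{\omega t}$ for all $t\ge 0$. The generator $(A,D(A))$ of $T$ is given by $$D(A)=\Big\{x\in X : \tau\text{-}\lim_{t\to0+}\tfrac{T(t)x-x}{t}\text{ exists and }\sup_{t\in(0,1]}\tfrac{\|T(t)x-x\|}{t}<\infty\Big\},\qquad Ax=\tau\text{-}\lim_{t\to0+}\tfrac{T(t)x-x}{t}.$$ Let $\rho(A)$ be the set of all $\lambda\in\mathbb{K}$ such that $\lambda-A\colon D(A)\to X$ is bijective with bounded inverse $R(\lambda,A):=(\lambda-A)^{-1}$.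 Let $T^\circ(t)$ be the restriction of the dual operator $T(t)'$ to $X^\circ$ (which leaves $X^\circ$ invariant), and let $A^\circ$ be the generator of $(T^\circ(t))_{t\ge0}$ with respect to $\|\cdot\|_{X'}$ and $\sigma(X^\circ,X)$ (same formula as above). Let $X^\bullet:=\{x^\circ\in X^\circ : \lim_{t\to0+}\|T^\circ(t)x^\circ-x^\circ\|_{X'}=0\}$, let $A^\bullet$ be the part of $A^\circ$ in $X^\bullet$, i.e. $D(A^\bullet)=\{x\in D(A^\circ)\cap X^\bullet : A^\circ x\in X^\bullet\}$ and $A^\bullet x=A^\circ x$, and for $\lambda\in\rho(A)$ let $R(\lambda,A)^\bullet:=R(\lambda,A)'|_{X^\bullet}$. Then the following hold. (a) If $\operatorname{Re}\lambda>\omega_0(T)$, then $\lambda\in\rho(A)$ and $R(\lambda,A)^\bullet X^\bullet\subset D(A^\bullet)$. (b) If $(X,\gamma)$ is a Mazur space (every $\gamma$-sequentially continuous linear functional on $X$ is $\gamma$-continuous) and $\lambda\in\rho(A)$ is such that $R(\lambda,A)\colon(X,\gamma)\to(X,\gamma)$ is continuous, then $R(\lambda,A)^\bullet X^\bullet\subset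 D(A^\bullet)$. (c) If $(X,\gamma)$ is C-sequential (every convex sequentially open subset of $(X,\gamma)$ is open), then $\{R(\lambda,A) : \operatorname{Re}\lambda\ge\alpha\}$ is $\gamma$-equicontinuous for every $\alpha>\omega_0(T)$. In particular, $R(\lambda,A)\colon(X,\gamma)\to(X,\gamma)$ is continuous whenever $\operatorname{Re}\lambda>\omega_0(T)$. -/

import Mathlib

open Filter Topology Set
open scoped NNReal

namespace BiSun

/-- A topology on `Y`, wrapped so that instance search never confuses it with the norm topology
that `Y` carries as well. -/
structure Topo (Y : Type*) where
  top : TopologicalSpace Y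

namespace Topo

/-- `u` converges to `y` along `l` in the topology `σ`. -/
def Lim {Y ι : Type*} (σ : Topo Y) (u : ι → Y) (l : Filter ι) (y : Y) : Prop :=
  Tendsto u l (@nhds Y σ.top y)

/-- The norm topology. -/
def ofNorm (Y : Type*) [NormedAddCommGroup Y] : Topo Y := ⟨inferInstance⟩

end Topo

section Operators

variable {𝕜 : Type*} [RCLike 𝕜] {Y : Type*} [NormedAddCommGroup Y] [NormedSpace 𝕜 Y]

/-- `σ` is a linear (i.e. vector space) topology. -/
structure IsVectorTopology (𝕜 : Type*) [RCLike 𝕜] {Y : Type*} [NormedAddCommGroup Y]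
    [NormedSpace 𝕜 Y] (σ : Topo Y) : Prop where
  addGroup : @IsTopologicalAddGroup Y σ.top _
  smul : @ContinuousSMul 𝕜 Y _ _ σ.top

/-- The difference quotient `(T(t)x - x) / t`. -/
noncomputable def diffQuot (T : ℝ≥0 → Y →L[𝕜] Y) (x : Y) (t : ℝ≥0) : Y :=
  (((t : ℝ) : 𝕜)⁻¹) • (T t x - x)

theorem diffQuot_add (T : ℝ≥0 → Y →L[𝕜] Y) (x y : Y) :
    diffQuot T (x + y) = fun t => diffQuot T x t + diffQuot T y t := by
  funext t
  simp only [diffQuot, map_add, ← smul_add]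
  congr 1
  abel

theorem diffQuot_smul (T : ℝ≥0 → Y →L[𝕜] Y) (c : 𝕜) (x : Y) :
    diffQuot T (c • x) = fun t => c • diffQuot T x t := by
  funext t
  simp only [diffQuot, map_smul, ← smul_sub]
  rw [smul_comm]

theorem diffQuot_zero (T : ℝ≥0 → Y →L[𝕜] Y) : diffQuot T (0 : Y) = fun _ => 0 := by
  funext t
  simp [diffQuot]

/-- The domain `D(A)` of the generator, with respect to the topology `σ`: the `σ`-limit of the
difference quotients at `0+` exists, and the quotients are norm bounded for `t ∈ (0, 1]`. -/
def generatorDomain (σ : Topo Y) (hσ : IsVectorTopology 𝕜 σ)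
    (T : ℝ≥0 → Y →L[𝕜] Y) : Submodule 𝕜 Y where
  carrier := {x | (∃ y, σ.Lim (diffQuot T x) (𝓝[>] 0) y) ∧
    ∃ C : ℝ, ∀ t : ℝ≥0, 0 < t → t ≤ 1 → ‖T t x - x‖ / t ≤ C}
  zero_mem' := by
    refine ⟨⟨0, ?_⟩, 0, fun t _ _ => by simp⟩
    rw [diffQuot_zero]
    let := σ.top
    exact tendsto_const_nhds (x := (0 : Y))
  add_mem' := by
    rintro x y ⟨⟨a, ha⟩, C, hC⟩ ⟨⟨b, hb⟩, D, hD⟩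
    refine ⟨⟨a + b, ?_⟩, C + D, fun t h0 h1 => ?_⟩
    · rw [diffQuot_add]
      let := σ.top
      have := hσ.addGroup
      exact ha.add hb
    · refine le_trans ?_ (add_le_add (hC t h0 h1) (hD t h0 h1))
      rw [← add_div]
      gcongr
      have : T t (x + y) - (x + y) = (T t x - x) + (T t y - y) := by
        rw [map_add]; abel
      rw [this]
      exact norm_add_le _ _
  smul_mem' := by
    rintro c x ⟨⟨a, ha⟩, C, hC⟩
    refine ⟨⟨c • a, ?_⟩, ‖c‖ * C, fun t h0 h1 => ?_⟩
    · rw [diffQuot_smul]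
      let := σ.top
      have := hσ.smul
      exact ha.const_smul c
    · rw [map_smul, ← smul_sub, norm_smul, mul_div_assoc]
      exact mul_le_mul_of_nonneg_left (hC t h0 h1) (norm_nonneg c)

/-- The generator `(A, D(A))` of `T` with respect to the Hausdorff linear topology `σ`:
`A x` is the `σ`-limit of `(T(t)x - x) / t` as `t → 0+`. -/
noncomputable def generator (σ : Topo Y) (hσ : IsVectorTopology 𝕜 σ)
    (hσ₂ : @T2Space Y σ.top) (T : ℝ≥0 → Y →L[𝕜] Y) : Y →ₗ.[𝕜] Y where
  domain := generatorDomain σ hσ T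
  toFun :=
    { toFun := fun x => Classical.choose (And.left x.2)
      map_add' := by
        intro x y
        refine @tendsto_nhds_unique _ _ σ.top hσ₂ _ _ _ _ _
          (Classical.choose_spec (And.left (x + y).2)) ?_
        have hx := Classical.choose_spec (And.left x.2)
        have hy := Classical.choose_spec y.2.1
        rw [Submodule.coe_add, diffQuot_add]
        let := σ.top
        have := hσ.addGroup
        exact hx.add hy
      map_smul' := by
        intro c x
        refine @tendsto_nhds_unique _ _ σ.top hσ₂ _ _ _ _ _
          (Classical.choose_spec (And.left (c • x).2)) ?_
        have hx := Classical.choose_spec (And.left x.2)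
        rw [Submodule.coe_smul, diffQuot_smul]
        let := σ.top
        have := hσ.smul
        exact hx.const_smul c }

/-- The part `A_{|Z}` of an operator `A` in a linear subspace `Z`:
`D(A_{|Z}) = {z ∈ D(A) ∩ Z | A z ∈ Z}` and `A_{|Z} z = A z`. -/
noncomputable def part (A : Y →ₗ.[𝕜] Y) (Z : Submodule 𝕜 Y) : Z →ₗ.[𝕜] Z where
  domain :=
    { carrier := {z | ∃ h : (z : Y) ∈ A.domain, A ⟨z, h⟩ ∈ Z}
      zero_mem' := ⟨A.domain.zero_mem, by
        have : (⟨((0 : Z) : Y), A.domain.zero_mem⟩ : A.domain) = 0 := rfl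
        rw [this, A.map_zero]
        exact Z.zero_mem⟩
      add_mem' := by
        rintro x y ⟨hx, hx'⟩ ⟨hy, hy'⟩
        refine ⟨A.domain.add_mem hx hy, ?_⟩
        have := A.map_add ⟨x, hx⟩ ⟨y, hy⟩
        exact this ▸ Z.add_mem hx' hy'
      smul_mem' := by
        rintro c x ⟨hx, hx'⟩
        refine ⟨A.domain.smul_mem c hx, ?_⟩
        have := A.map_smul c ⟨x, hx⟩
        exact this ▸ Z.smul_mem c hx' }
  toFun :=
    { toFun := fun z => ⟨A ⟨z.1, z.2.choose⟩, z.2.choose_spec⟩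
      map_add' := fun x y => Subtype.ext (A.map_add ⟨x.1, x.2.choose⟩ ⟨y.1, y.2.choose⟩)
      map_smul' := fun c x => Subtype.ext (A.map_smul c ⟨x.1, x.2.choose⟩) }

/-- The resolvent set `ρ(A)`: all scalars `μ` such that `μ - A : D(A) → Y` is bijective with a
bounded inverse. -/
def resolventSet (A : Y →ₗ.[𝕜] Y) : Set 𝕜 :=
  {μ | Function.Bijective (fun x : A.domain => μ • (x : Y) - A x) ∧
    ∃ R : Y →L[𝕜] Y, ∀ x : A.domain, R (μ • (x : Y) - A x) = x}

open Classical in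
/-- The resolvent `R(μ, A) = (μ - A)⁻¹` for `μ ∈ ρ(A)` (and `0` otherwise). -/
noncomputable def resolvent (A : Y →ₗ.[𝕜] Y) (μ : 𝕜) : Y →L[𝕜] Y :=
  if h : μ ∈ resolventSet A then Classical.choose h.2 else 0

/-- The growth bound `ω₀(T) ∈ [-∞, ∞]`. -/
noncomputable def growthBound (T : ℝ≥0 → Y →L[𝕜] Y) : EReal :=
  sInf ((fun ω : ℝ => (ω : EReal)) ''
    {ω : ℝ | ∃ M : ℝ, 1 ≤ M ∧ ∀ t : ℝ≥0, ‖T t‖ ≤ M * Real.exp (ω * t)})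

/-- The space of norm strong continuity: all `x` with `‖T(t)x - x‖ → 0` as `t → 0+`. -/
def strongContSpace (T : ℝ≥0 → Y →L[𝕜] Y) : Submodule 𝕜 Y where
  carrier := {x | Tendsto (fun t => ‖T t x - x‖) (𝓝[>] 0) (𝓝 0)}
  zero_mem' := by simp
  add_mem' := by
    intro x y hx hy
    simp only [mem_ofPred_eq, ← tendsto_iff_norm_sub_tendsto_zero] at *
    simpa using hx.add hy
  smul_mem' := by
    intro c x hx
    simp only [mem_ofPred_eq, ← tendsto_iff_norm_sub_tendsto_zero] at *
    simpa using hx.const_smul c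

end Operators

section Triples

variable {𝕜 : Type*} [RCLike 𝕜] {X : Type*} [NormedAddCommGroup X] [NormedSpace 𝕜 X]

/-- The standing assumption on a triple `(X, ‖·‖, τ)`: `τ` is a Hausdorff locally convex topology
coarser than the norm topology, sequentially complete on norm bounded sets, and `(X, τ)'` is
norming. (In Mathlib's order on topologies, `s ≤ t` says that `t` is the coarser one.) -/
structure IsStandardTriple (𝕜 : Type*) [RCLike 𝕜] {X : Type*} [NormedAddCommGroup X]
    [NormedSpace 𝕜 X] [NormedSpace ℝ X] (τ : Topo X) : Prop where
  linear : IsVectorTopology 𝕜 τ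
  t2 : @T2Space X τ.top
  locallyConvex : @LocallyConvexSpace ℝ X _ _ _ _ τ.top
  coarser : (Topo.ofNorm X).top ≤ τ.top
  seqComplete : ∀ u : ℕ → X, Bornology.IsBounded (range u) →
    (∀ U ∈ @nhds X τ.top 0, ∃ N, ∀ m ≥ N, ∀ n ≥ N, u m - u n ∈ U) →
    ∃ x, τ.Lim u atTop x
  norming : ∀ x : X, IsLUB
    {r : ℝ | ∃ y : StrongDual 𝕜 X, @Continuous X 𝕜 τ.top _ y ∧ ‖y‖ ≤ 1 ∧ r = ‖y x‖} ‖x‖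

/-- The mixed topology `γ(‖·‖, τ)`: the finest linear topology which coincides with `τ` on norm
bounded sets and lies between `τ` and the norm topology (`sInf` is the common refinement). -/
def mixedTopology (𝕜 : Type*) [RCLike 𝕜] {X : Type*} [NormedAddCommGroup X]
    [NormedSpace 𝕜 X] (τ : Topo X) : Topo X :=
  ⟨sInf (Topo.top '' {σ : Topo X | IsVectorTopology 𝕜 σ ∧
    (∀ B : Set X, Bornology.IsBounded B →
      TopologicalSpace.induced ((↑) : B → X) σ.top =
        TopologicalSpace.induced ((↑) : B → X) τ.top) ∧
    (Topo.ofNorm X).top ≤ σ.top ∧ σ.top ≤ τ.top})⟩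

/-- `(X, ϑ)` is a Mazur space: sequentially continuous linear functionals are continuous. -/
def IsMazur (𝕜 : Type*) [RCLike 𝕜] {X : Type*} [NormedAddCommGroup X]
    [NormedSpace 𝕜 X] (ϑ : Topo X) : Prop :=
  ∀ f : X →ₗ[𝕜] 𝕜, @SeqContinuous X 𝕜 ϑ.top _ f → @Continuous X 𝕜 ϑ.top _ f

/-- `(X, ϑ)` is C-sequential: every convex sequentially open subset is open. -/
def IsCSequential {X : Type*} [NormedAddCommGroup X] [NormedSpace ℝ X]
    (ϑ : Topo X) : Prop :=
  ∀ U : Set X, Convex ℝ U →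
    (∀ (u : ℕ → X) (x : X), x ∈ U → ϑ.Lim u atTop x → ∀ᶠ n in atTop, u n ∈ U) →
    @IsOpen X ϑ.top U

/-- A family of linear operators is equicontinuous for the linear topology `ϑ`. -/
def IsEquicontinuousFamily (ϑ : Topo X) (F : Set (X →L[𝕜] X)) : Prop :=
  ∀ U ∈ @nhds X ϑ.top 0, ∃ V ∈ @nhds X ϑ.top 0, ∀ S ∈ F, ∀ x ∈ V, S x ∈ U

/-- `T` is a `τ`-bi-continuous semigroup on `X`. -/
structure IsBiContinuous (τ : Topo X) (T : ℝ≥0 → X →L[𝕜] X) : Prop where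
  zero : T 0 = ContinuousLinearMap.id 𝕜 X
  add : ∀ t s, T (t + s) = (T t).comp (T s)
  strong : ∀ x, @Continuous ℝ≥0 X _ τ.top (fun t => T t x)
  expBounded : ∃ M : ℝ, 1 ≤ M ∧ ∃ ω : ℝ, ∀ t : ℝ≥0, ‖T t‖ ≤ M * Real.exp (ω * t)
  biEquicontinuous : ∀ (u : ℕ → X) (x : X), Bornology.IsBounded (range u) →
    τ.Lim u atTop x →
    ∀ t₀ : ℝ≥0, ∀ U ∈ @nhds X τ.top 0, ∀ᶠ n in atTop, ∀ t ≤ t₀, T t (u n - x) ∈ U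

/-- `X°`: the functionals in `X'` that are `τ`-sequentially continuous on norm bounded sets. -/
def circDual (𝕜 : Type*) [RCLike 𝕜] {X : Type*} [NormedAddCommGroup X]
    [NormedSpace 𝕜 X] (τ : Topo X) : Submodule 𝕜 (StrongDual 𝕜 X) where
  carrier := {f | ∀ (u : ℕ → X) (x : X), Bornology.IsBounded (range u) →
    τ.Lim u atTop x → Tendsto (fun n => f (u n)) atTop (𝓝 (f x))}
  zero_mem' := by
    intro u x _ _
    simp
  add_mem' := by
    intro f g hf hg u x hu hx
    simpa using (hf u x hu hx).add (hg u x hu hx)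
  smul_mem' := by
    intro c f hf u x hu hx
    simpa using (hf u x hu hx).const_smul c

/-- The topology `σ(X°, X)` of pointwise convergence on `X`. -/
def circWeak (τ : Topo X) : Topo (circDual 𝕜 τ) :=
  ⟨TopologicalSpace.induced (fun f (x : X) => (f : StrongDual 𝕜 X) x) Pi.topologicalSpace⟩

theorem circWeak_linear (τ : Topo X) :
    IsVectorTopology 𝕜 (circWeak (𝕜 := 𝕜) τ) := by
  let φ : circDual 𝕜 τ →ₗ[𝕜] (X → 𝕜) :=
    { toFun := fun f x => (f : StrongDual 𝕜 X) x
      map_add' := fun _ _ => rfl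
      map_smul' := fun _ _ => rfl }
  exact ⟨topologicalAddGroup_induced φ, continuousSMul_induced φ⟩

theorem circWeak_t2 (τ : Topo X) :
    @T2Space (circDual 𝕜 τ) (circWeak (𝕜 := 𝕜) τ).top := by
  let := (circWeak (𝕜 := 𝕜) τ).top
  refine T2Space.of_injective_continuous
    (f := fun (f : circDual 𝕜 τ) (x : X) => (f : StrongDual 𝕜 X) x) ?_ continuous_induced_dom
  intro f g h
  exact Subtype.ext (ContinuousLinearMap.ext fun x => congrFun h x)

/-- The assumption on the dual side: (i) `X° ∩ B` is sequentially complete for `σ(X°, X)`, with `B`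
the closed unit ball of `X'`; (ii) every norm bounded `σ(X°, X)`-null sequence in `X°` is
`τ`-equicontinuous on norm bounded sets. -/
structure IsDualAdmissible (𝕜 : Type*) [RCLike 𝕜] {X : Type*} [NormedAddCommGroup X]
    [NormedSpace 𝕜 X] (τ : Topo X) : Prop where
  seqComplete : ∀ f : ℕ → StrongDual 𝕜 X, (∀ n, f n ∈ circDual 𝕜 τ ∧ ‖f n‖ ≤ 1) →
    (∀ x, CauchySeq fun n => f n x) →
    ∃ g ∈ circDual 𝕜 τ, ‖g‖ ≤ 1 ∧ ∀ x, Tendsto (fun n => f n x) atTop (𝓝 (g x))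
  equicontinuous : ∀ f : ℕ → StrongDual 𝕜 X, (∀ n, f n ∈ circDual 𝕜 τ) →
    Bornology.IsBounded (range f) → (∀ x, Tendsto (fun n => f n x) atTop (𝓝 0)) →
    ∀ B : Set X, Bornology.IsBounded B → @EquicontinuousOn ℕ X 𝕜 τ.top _ (fun n x => f n x) B

/-- The dual operator `S' : X' → X'`, `S' f = f ∘ S`. -/
noncomputable def dualOp (S : X →L[𝕜] X) : StrongDual 𝕜 X →L[𝕜] StrongDual 𝕜 X :=
  (ContinuousLinearMap.compL 𝕜 X X 𝕜).flip S

theorem dualOp_mem_circDual {τ : Topo X} (hτ : IsVectorTopology 𝕜 τ)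
    {T : ℝ≥0 → X →L[𝕜] X} (hT : IsBiContinuous τ T) (t : ℝ≥0) {f : StrongDual 𝕜 X}
    (hf : f ∈ circDual 𝕜 τ) : dualOp (T t) f ∈ circDual 𝕜 τ := by
  intro u x hu hx
  refine hf (fun n => T t (u n)) (T t x) ?_ ?_
  · have : range (fun n => T t (u n)) = T t '' range u := by
      rw [← range_comp]; rfl
    rw [this]
    exact (T t).lipschitz.isBounded_image hu
  · have h : Tendsto (fun n => T t (u n - x)) atTop (@nhds X τ.top 0) := fun U hU =>
      (hT.biEquicontinuous u x hu hx t U hU).mono fun n hn => hn t le_rfl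
    let := τ.top
    have := hτ.addGroup
    have h2 := h.add (tendsto_const_nhds (x := T t x))
    change Tendsto _ _ (@nhds X τ.top _)
    simpa [map_sub] using h2

/-- The restriction `T°(t)` of `T(t)'` to `X°`. -/
noncomputable def circSemigroup {τ : Topo X} (hτ : IsVectorTopology 𝕜 τ)
    {T : ℝ≥0 → X →L[𝕜] X} (hT : IsBiContinuous τ T) (t : ℝ≥0) :
    circDual 𝕜 τ →L[𝕜] circDual 𝕜 τ :=
  ((dualOp (T t)).comp (circDual 𝕜 τ).subtypeL).codRestrict (circDual 𝕜 τ)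
    fun f => dualOp_mem_circDual hτ hT t f.2

/-- `A°`: the generator of `T°` with respect to `σ(X°, X)`. -/
noncomputable def circGenerator {τ : Topo X} (hτ : IsVectorTopology 𝕜 τ)
    {T : ℝ≥0 → X →L[𝕜] X} (hT : IsBiContinuous τ T) : circDual 𝕜 τ →ₗ.[𝕜] circDual 𝕜 τ :=
  generator (circWeak τ) (circWeak_linear τ) (circWeak_t2 τ) (circSemigroup hτ hT)

/-- The bi-sun dual `X•`: the subspace of `X°` on which `T°` is norm strongly continuous. -/
noncomputable def bullet {τ : Topo X} (hτ : IsVectorTopology 𝕜 τ)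
    {T : ℝ≥0 → X →L[𝕜] X} (hT : IsBiContinuous τ T) :=
  strongContSpace (𝕜 := 𝕜) (Y := circDual 𝕜 τ) (circSemigroup hτ hT)

/-- `A•`: the part of `A°` in `X•`. -/
noncomputable def bulletGenerator {τ : Topo X} (hτ : IsVectorTopology 𝕜 τ)
    {T : ℝ≥0 → X →L[𝕜] X} (hT : IsBiContinuous τ T) : bullet hτ hT →ₗ.[𝕜] bullet hτ hT :=
  part (circGenerator hτ hT) (bullet hτ hT)

/-- `D(A•)`, seen as a subset of `X'` (through `X• ⊆ X° ⊆ X'`). -/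
def bulletDomain {τ : Topo X} (hτ : IsVectorTopology 𝕜 τ)
    {T : ℝ≥0 → X →L[𝕜] X} (hT : IsBiContinuous τ T) : Set (StrongDual 𝕜 X) :=
  (fun g : bullet hτ hT => ((g : circDual 𝕜 τ) : StrongDual 𝕜 X)) ''
    ((bulletGenerator hτ hT).domain : Set (bullet hτ hT))

/-- The restriction `S• : X• → X'` of the dual operator `S'` to `X•`. -/
noncomputable def bulletOp {τ : Topo X} (hτ : IsVectorTopology 𝕜 τ)
    {T : ℝ≥0 → X →L[𝕜] X} (hT : IsBiContinuous τ T) (S : X →L[𝕜] X) :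
    bullet hτ hT →L[𝕜] StrongDual 𝕜 X :=
  (dualOp S).comp ((circDual 𝕜 τ).subtypeL.comp (bullet hτ hT).subtypeL)

end Triples

end BiSun

/-!
The proof rests on one device: the functionals in `X°` see enough of `X`. They separate points,
they compute the norm (`IsStandardTriple.norm_le_of_circDual`), every `τ`-continuous seminorm is
attained on functionals in `X°` that it dominates (`IsStandardTriple.exists_circDual_of_seminorm`),
and they are stable under the duals of the operators `T(t)`, which the `τ`-continuous functionals
need not be. So an integral in `X` can be handled through the scalar integrals of its pairings with
`X°`.

*The resolvent is a Laplace transform.* For `re μ > ω₀(T)` the rescaled semigroup `e^{-μ t} T(t)`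
decays exponentially, and `IsStandardTriple.exists_integral_Ioi` gives an operator `R` with
`f (R x) = ∫₀^∞ f (e^{-μ s} T(s) x) ds` for `f ∈ X°`. Translating the integral shows that
`(T(t) R x - R x) / t` is bounded in norm and tends to `μ R x - x` in `τ`, so `(μ - A) R = 1`. By
dominated convergence `R` is `τ`-sequentially continuous on norm bounded sets; as it commutes with
`T(t)`, also `R (μ - A) = 1` on `D(A)`. This is `IsStandardTriple.resolvent_eq_laplace`.

*The bi-sun dual.* Let `R = R(μ, A)` and `f ∈ X•`. If `g = f ∘ R` lies in `X°`, then
`(T°(t) g - g) / t = f ∘ (T(t) R - R) / t` is norm bounded by the uniform boundedness principle and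
tends pointwise to `f ∘ A R = μ g - f`. Hence `g ∈ D(A°)`, `g ∈ X•` and `A° g = μ g - f ∈ X•`
(`range_bulletOp_resolvent_subset`). It remains to see that `R` is `τ`-sequentially continuous on
norm bounded sets. For a Laplace transform this is the fact above; for an `R` that is continuous for
the mixed topology `γ` it holds because bounded `τ`-convergent sequences are `γ`-convergent.

*Equicontinuity.* The topology `γ` is generated by the seminorms `p` that are `τ`-continuous on norm
bounded sets (`IsStandardTriple.lt_mem_nhds_mixedTopology`,
`IsStandardTriple.exists_isMixedSeminorm_subset`), and `γ`-convergent sequences are norm bounded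
(`IsStandardTriple.isBounded_range_of_lim`). For `re μ ≥ α` one has
`p (R(μ, A) x) ≤ ∫₀^∞ e^{-α s} p (T(s) x) ds` when `p` is `τ`-continuous, with a right-hand side
that is independent of `μ`, so the resolvents tend to zero along `γ`-null sequences uniformly in
`μ`. Consequently the convex set where `p (R(μ, A) x)` stays uniformly below `1` is sequentially
open, and in a C-sequential space it is a neighbourhood of the origin.
-/

open MeasureTheory

namespace BiSun

/-! ### Seminorms continuous for a locally convex topology -/

section Seminorms

section Generic

variable {𝕜 E : Type*} [RCLike 𝕜] [AddCommGroup E] [Module 𝕜 E]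

/-- Hahn–Banach: a seminorm is attained at a point by a functional that it dominates. -/
theorem exists_dual_eq_seminorm (p : Seminorm 𝕜 E) (z : E) :
    ∃ g : Module.Dual 𝕜 E, g z = ((p z : ℝ) : 𝕜) ∧ ∀ x, ‖g x‖ ≤ p x := by
  by_cases hz : z = 0
  · exact ⟨0, by simp [hz], by simp⟩
  let e := LinearEquiv.toSpanNonzeroSingleton 𝕜 E z hz
  let f : Module.Dual 𝕜 (𝕜 ∙ z) := ((p z : ℝ) : 𝕜) • (e.symm : (𝕜 ∙ z) →ₗ[𝕜] 𝕜)
  have hf : ∀ c : 𝕜, f (e c) = ((p z : ℝ) : 𝕜) * c := fun c => by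
    simp [f, RCLike.real_smul_eq_coe_mul]
  obtain ⟨g, hg, hgp⟩ := Module.Dual.exists_extension_of_le_seminorm _ f (p := p) fun x => by
    obtain ⟨c, rfl⟩ := e.surjective x
    rw [hf, norm_mul, RCLike.norm_ofReal, abs_of_nonneg (apply_nonneg p z), mul_comm]
    exact (map_smul_eq_mul p c z).ge
  refine ⟨g, ?_, hgp⟩
  have := hg (e 1)
  rw [hf, mul_one] at this
  simpa [e] using this

variable [TopologicalSpace E]

theorem tendsto_nhds_iff_seminorm {ι α : Type*} {p : SeminormFamily 𝕜 E ι}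
    (hp : WithSeminorms p) {u : α → E} {l : Filter α} {x : E} :
    Tendsto u l (𝓝 x) ↔ ∀ i, Tendsto (fun a => p i (u a - x)) l (𝓝 0) := by
  rw [hp.tendsto_nhds' u x]
  constructor
  · intro H i
    rw [Metric.tendsto_nhds]
    intro ε hε
    simpa [abs_of_nonneg] using H {i} ε hε
  · intro H s ε hε
    have : ∀ i ∈ s, ∀ᶠ a in l, p i (u a - x) < ε := fun i _ =>
      (H i).eventually (gt_mem_nhds hε)
    filter_upwards [(eventually_all_finset s).2 this] with a ha
    exact Seminorm.finset_sup_apply_lt hε ha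

variable [Module ℝ E] [IsScalarTower ℝ 𝕜 E] [LocallyConvexSpace ℝ E]

open scoped ComplexOrder in
variable (𝕜 E) in
theorem locallyConvexSpace_rclike_of_real : LocallyConvexSpace 𝕜 E := by
  refine ⟨fun x => ?_⟩
  simp only [convex_RCLike_iff_convex_real]
  exact LocallyConvexSpace.convex_basis (𝕜 := ℝ) x

variable [IsTopologicalAddGroup E] [ContinuousSMul 𝕜 E]

variable (𝕜 E) in
/-- A real-locally convex `𝕜`-vector topology is generated by its continuous `𝕜`-seminorms. -/
theorem polynormableSpace_of_locallyConvex_real : PolynormableSpace 𝕜 E := by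
  open scoped ComplexOrder in
  have : ContinuousSMul ℝ E := IsScalarTower.continuousSMul 𝕜
  have := locallyConvexSpace_rclike_of_real 𝕜 E
  infer_instance

theorem exists_continuous_seminorm_lt_one_subset {U : Set E} (hU : U ∈ 𝓝 (0 : E)) :
    ∃ p : Seminorm 𝕜 E, Continuous p ∧ ∀ x, p x < 1 → x ∈ U := by
  open scoped ComplexOrder in
  have : ContinuousSMul ℝ E := IsScalarTower.continuousSMul 𝕜
  have := locallyConvexSpace_rclike_of_real 𝕜 E
  obtain ⟨s, hs, hsU⟩ := (nhds_hasBasis_absConvex_open 𝕜 E).mem_iff.1 hU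
  refine ⟨gaugeSeminormFamily 𝕜 E ⟨s, hs⟩,
    (with_gaugeSeminormFamily (𝕜 := 𝕜) (E := E)).continuous_seminorm _, fun x hx => hsU ?_⟩
  have := gaugeSeminormFamily_ball (𝕜 := 𝕜) (⟨s, hs⟩ : AbsConvexOpenSets 𝕜 E)
  change x ∈ ((⟨s, hs⟩ : AbsConvexOpenSets 𝕜 E) : Set E)
  rw [← this, Seminorm.mem_ball, sub_zero]
  exact hx

end Generic

variable {𝕜 : Type*} [RCLike 𝕜] {X : Type*} [NormedAddCommGroup X] [NormedSpace 𝕜 X]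
  {τ : Topo X}

/-- The seminorm `p` is continuous for the topology `σ`. -/
def IsContSeminorm (σ : Topo X) (p : Seminorm 𝕜 X) : Prop :=
  @Continuous X ℝ σ.top _ p

/-- Functionals in `X°` are continuous along norm bounded families over countably generated
filters, not only along sequences. -/
theorem tendsto_of_mem_circDual {f : StrongDual 𝕜 X} (hf : f ∈ circDual 𝕜 τ) {ι : Type*}
    {u : ι → X} {l : Filter ι} [l.IsCountablyGenerated] {x : X} {C : ℝ}
    (hC : ∀ᶠ i in l, ‖u i‖ ≤ C) (hu : τ.Lim u l x) :
    Tendsto (fun i => f (u i)) l (𝓝 (f x)) := by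
  refine tendsto_of_seq_tendsto fun v hv => ?_
  obtain ⟨N, hN⟩ := eventually_atTop.1 (hv.eventually hC)
  rw [← tendsto_add_atTop_iff_nat N]
  refine hf (fun n => u (v (n + N))) x ?_ ?_
  · exact (isBounded_iff_forall_norm_le).2 ⟨C, by rintro _ ⟨n, rfl⟩; exact hN _ (by omega)⟩
  · exact Tendsto.comp hu (hv.comp (tendsto_add_atTop_nat N))

variable [NormedSpace ℝ X] (hτ : IsStandardTriple 𝕜 τ)
include hτ

theorem IsStandardTriple.exists_seminorm_bound {p : Seminorm 𝕜 X} (hp : IsContSeminorm τ p) :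
    ∃ C, 0 < C ∧ ∀ x, p x ≤ C * ‖x‖ :=
  Seminorm.bound_of_continuous_normedSpace p (continuous_le_dom hτ.coarser hp)

theorem IsStandardTriple.norm_le_of_circDual {x : X} {C : ℝ}
    (h : ∀ f ∈ circDual 𝕜 τ, ‖f‖ ≤ 1 → ‖f x‖ ≤ C) : ‖x‖ ≤ C := by
  refine (hτ.norming x).2 ?_
  rintro _ ⟨y, hy, hy1, rfl⟩
  refine h y (fun u x _ hu => ?_) hy1
  let := τ.top
  exact (hy.tendsto x).comp hu

/-- `X°` separates the points of `X`. -/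
theorem IsStandardTriple.eq_of_circDual {x y : X} (h : ∀ f ∈ circDual 𝕜 τ, f x = f y) : x = y := by
  rw [← sub_eq_zero, ← norm_le_zero_iff]
  refine hτ.norm_le_of_circDual fun f hf _ => ?_
  simp [h f hf]

variable [IsScalarTower ℝ 𝕜 X]

theorem IsStandardTriple.lim_iff {ι : Type*} {u : ι → X} {l : Filter ι} {x : X} :
    τ.Lim u l x ↔ ∀ p : Seminorm 𝕜 X, IsContSeminorm τ p →
      Tendsto (fun i => p (u i - x)) l (𝓝 0) := by
  have := @polynormableSpace_of_locallyConvex_real 𝕜 X _ _ _ τ.top _ _ hτ.locallyConvex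
    hτ.linear.addGroup hτ.linear.smul
  refine (@tendsto_nhds_iff_seminorm 𝕜 X _ _ _ τ.top _ ι _
    (@PolynormableSpace.withSeminorms 𝕜 X _ _ _ τ.top this) u l x).trans ?_
  exact Subtype.forall

theorem IsStandardTriple.exists_seminorm_ball_subset {U : Set X} (hU : U ∈ @nhds X τ.top 0) :
    ∃ p : Seminorm 𝕜 X, IsContSeminorm τ p ∧ ∀ x, p x < 1 → x ∈ U :=
  @exists_continuous_seminorm_lt_one_subset 𝕜 X _ _ _ τ.top _ _ hτ.locallyConvex
    hτ.linear.addGroup hτ.linear.smul U hU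

/-- Hahn–Banach: `p z` is attained at a functional dominated by `p`, and such a functional lies
in `X°`. -/
theorem IsStandardTriple.exists_circDual_of_seminorm {p : Seminorm 𝕜 X} (hp : IsContSeminorm τ p)
    (z : X) : ∃ y ∈ circDual 𝕜 τ, y z = ((p z : ℝ) : 𝕜) ∧ ∀ x, ‖y x‖ ≤ p x := by
  obtain ⟨g, hgz, hg⟩ := exists_dual_eq_seminorm p z
  obtain ⟨C, -, hC⟩ := hτ.exists_seminorm_bound hp
  refine ⟨g.mkContinuous C fun x => (hg x).trans (hC x), fun u x _ hu => ?_, hgz, hg⟩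
  rw [tendsto_iff_norm_sub_tendsto_zero]
  refine squeeze_zero (fun _ => norm_nonneg _) (fun n => ?_) (hτ.lim_iff.1 hu p hp)
  rw [← map_sub]
  exact hg _

end Seminorms

/-! ### Integrals of functions continuous for the coarse topology -/

section WeakIntegral

/-- The sampling point of `s` in the grid of mesh `1 / (n + 1)`. -/
noncomputable def gridPoint (n : ℕ) (s : ℝ) : ℝ := (⌊s * ((n : ℝ) + 1)⌋₊ : ℝ) / ((n : ℝ) + 1)

theorem gridPoint_nonneg (n : ℕ) (s : ℝ) : 0 ≤ gridPoint n s := by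
  unfold gridPoint; positivity

theorem sub_one_le_gridPoint (n : ℕ) (s : ℝ) : s - 1 ≤ gridPoint n s := by
  have h0 : (0 : ℝ) < (n : ℝ) + 1 := by positivity
  rw [gridPoint, le_div_iff₀ h0]
  have := (Nat.lt_floor_add_one (s * ((n : ℝ) + 1))).le
  nlinarith [(Nat.cast_nonneg n : (0 : ℝ) ≤ n)]

theorem tendsto_gridPoint {s : ℝ} (hs : 0 ≤ s) :
    Tendsto (fun n => gridPoint n s) atTop (𝓝 s) :=
  (tendsto_nat_floor_mul_div_atTop hs).comp
    (tendsto_atTop_add_const_right _ 1 tendsto_natCast_atTop_atTop)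

theorem stronglyMeasurable_comp_gridPoint {Y : Type*} [TopologicalSpace Y] (F : ℝ → Y) (n : ℕ) :
    StronglyMeasurable fun s => F (gridPoint n s) := by
  have h : StronglyMeasurable fun k : ℕ => F ((k : ℝ) / ((n : ℝ) + 1)) :=
    StronglyMeasurable.of_discrete
  exact h.comp_measurable (Nat.measurable_floor.comp (measurable_id.mul_const _))

variable {𝕜 : Type*} [RCLike 𝕜] {X : Type*} [NormedAddCommGroup X] [NormedSpace 𝕜 X]
  {τ : Topo X}

theorem continuous_of_mem_circDual {f : StrongDual 𝕜 X} (hf : f ∈ circDual 𝕜 τ) {F : ℝ → X}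
    (hF : ∀ s, τ.Lim F (𝓝 s) (F s)) {C : ℝ → ℝ} (hC : Continuous C) (hb : ∀ s, ‖F s‖ ≤ C s) :
    Continuous fun s => f (F s) := by
  rw [continuous_iff_continuousAt]
  intro s
  refine tendsto_of_mem_circDual hf (C := C s + 1) ?_ (hF s)
  filter_upwards [hC.continuousAt.eventually (gt_mem_nhds (lt_add_one (C s)))] with r hr
  exact (hb r).trans hr.le

variable [NormedSpace ℝ X] (hτ : IsStandardTriple 𝕜 τ)
include hτ

/-- The norm inequality for weakly defined integrals. -/
theorem IsStandardTriple.norm_le_integral {α : Type*} [MeasurableSpace α] {ν : Measure α}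
    {F : α → X} {z : X} (hz : ∀ f ∈ circDual 𝕜 τ, f z = ∫ s, f (F s) ∂ν)
    {b : α → ℝ} (hb : Integrable b ν) (hF : ∀ᵐ s ∂ν, ‖F s‖ ≤ b s) : ‖z‖ ≤ ∫ s, b s ∂ν := by
  refine hτ.norm_le_of_circDual fun f hf h1 => ?_
  rw [hz f hf]
  refine norm_integral_le_of_norm_le hb (hF.mono fun s hs => ?_)
  exact (f.le_of_opNorm_le h1 _).trans (by rwa [one_mul])

variable [IsScalarTower ℝ 𝕜 X]

/-- The triangle inequality for weakly defined integrals. -/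
theorem IsStandardTriple.seminorm_le_integral {α : Type*} [MeasurableSpace α] {ν : Measure α}
    {F : α → X} {z : X} (hz : ∀ f ∈ circDual 𝕜 τ, f z = ∫ s, f (F s) ∂ν)
    {p : Seminorm 𝕜 X} (hp : IsContSeminorm τ p) (hi : Integrable (fun s => p (F s)) ν) :
    p z ≤ ∫ s, p (F s) ∂ν := by
  obtain ⟨y, hy, hyz, hyp⟩ := hτ.exists_circDual_of_seminorm hp z
  calc p z = ‖y z‖ := by rw [hyz, RCLike.norm_ofReal, abs_of_nonneg (apply_nonneg p z)]
    _ = ‖∫ s, y (F s) ∂ν‖ := by rw [hz y hy]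
    _ ≤ ∫ s, ‖y (F s)‖ ∂ν := norm_integral_le_integral_norm _
    _ ≤ ∫ s, p (F s) ∂ν := integral_mono_of_nonneg
        (Eventually.of_forall fun _ => norm_nonneg _) hi (Eventually.of_forall fun s => hyp _)

/-- A function on `[0, ∞)` that is continuous for `τ` and decays exponentially in norm has an
integral in `X`, taken weakly against `X°`. The integral is the `τ`-limit of the Bochner integrals
of the step functions that sample `F` on finer and finer grids; these are `τ`-Cauchy by dominated
convergence, applied to the scalar functions `p (F_m - F_n)`. -/
theorem IsStandardTriple.exists_integral_Ioi [CompleteSpace X] {F : ℝ → X}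
    (hF : ∀ s, τ.Lim F (𝓝 s) (F s)) {C ε : ℝ} (hε : 0 < ε)
    (hb : ∀ s, 0 ≤ s → ‖F s‖ ≤ C * Real.exp (-ε * s)) :
    ∃ z, ∀ f ∈ circDual 𝕜 τ, f z = ∫ s in Ioi (0 : ℝ), f (F s) := by
  have hC : 0 ≤ C := by simpa using (norm_nonneg _).trans (hb 0 le_rfl)
  let G : ℕ → ℝ → X := fun n s => F (gridPoint n s)
  -- The factor `exp ε` accounts for `s - 1 ≤ gridPoint n s`.
  let b : ℝ → ℝ := fun s => C * Real.exp ε * Real.exp (-ε * s)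
  have hbi : Integrable b (volume.restrict (Ioi 0)) :=
    (exp_neg_integrableOn_Ioi 0 hε).const_mul _
  have hGb : ∀ n s, ‖G n s‖ ≤ b s := fun n s => by
    refine (hb _ (gridPoint_nonneg n s)).trans ?_
    simp only [b]
    rw [mul_assoc, ← Real.exp_add]
    gcongr
    nlinarith [sub_one_le_gridPoint n s]
  have hGm : ∀ n, StronglyMeasurable (G n) := fun n => stronglyMeasurable_comp_gridPoint F n
  have hGi : ∀ n, Integrable (G n) (volume.restrict (Ioi 0)) := fun n =>
    hbi.mono' (hGm n).aestronglyMeasurable (Eventually.of_forall (hGb n))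
  have hGlim : ∀ s, 0 ≤ s → τ.Lim (fun n => G n s) atTop (F s) := fun s hs =>
    Tendsto.comp (hF s) (tendsto_gridPoint hs)
  let S : ℕ → X := fun n => ∫ s in Ioi (0 : ℝ), G n s
  have hSb : ∀ n, ‖S n‖ ≤ ∫ s in Ioi (0 : ℝ), b s := fun n =>
    norm_integral_le_of_norm_le hbi (Eventually.of_forall (hGb n))
  obtain ⟨z, hz⟩ := hτ.seqComplete S
    (isBounded_iff_forall_norm_le.2 ⟨_, by rintro _ ⟨n, rfl⟩; exact hSb n⟩) (by
      intro U hU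
      obtain ⟨p, hp, hpU⟩ := hτ.exists_seminorm_ball_subset hU
      obtain ⟨K, hK0, hK⟩ := hτ.exists_seminorm_bound hp
      have hpc : Continuous p := continuous_le_dom hτ.coarser hp
      have hle : ∀ m n s, p (G m s - G n s) ≤ K * (b s + b s) := fun m n s =>
        (hK _).trans (by gcongr; exact (norm_sub_le _ _).trans (add_le_add (hGb m s) (hGb n s)))
      have hm : ∀ m n, AEStronglyMeasurable (fun s => p (G m s - G n s))
          (volume.restrict (Ioi (0 : ℝ))) := fun m n =>
        (hpc.comp_stronglyMeasurable ((hGm m).sub (hGm n))).aestronglyMeasurable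
      have hint : ∀ m n, Integrable (fun s => p (G m s - G n s)) (volume.restrict (Ioi (0 : ℝ))) :=
        fun m n => ((hbi.add hbi).const_mul K).mono' (hm m n) (Eventually.of_forall fun s => by
          rw [Real.norm_of_nonneg (apply_nonneg p _)]; exact hle m n s)
      have hlim : Tendsto (fun q : ℕ × ℕ => ∫ s in Ioi (0 : ℝ), p (G q.1 s - G q.2 s))
          (atTop ×ˢ atTop) (𝓝 (∫ s in Ioi (0 : ℝ), (0 : ℝ))) := by
        refine tendsto_integral_filter_of_dominated_convergence (fun s => K * (b s + b s))
          (Eventually.of_forall fun q => hm q.1 q.2)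
          (Eventually.of_forall fun q => Eventually.of_forall fun s => ?_)
          ((hbi.add hbi).const_mul K) ?_
        · rw [Real.norm_of_nonneg (apply_nonneg p _)]; exact hle _ _ s
        · filter_upwards [ae_restrict_mem measurableSet_Ioi] with s hs
          have h := hτ.lim_iff.1 (hGlim s (le_of_lt hs)) p hp
          have h2 := (h.comp (tendsto_fst (f := atTop) (g := atTop (α := ℕ)))).add
            (h.comp (tendsto_snd (f := atTop (α := ℕ)) (g := atTop)))
          rw [add_zero] at h2
          refine squeeze_zero (fun _ => apply_nonneg p _) (fun q => ?_) h2
          have := map_sub_le_add p (G q.1 s - F s) (G q.2 s - F s)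
          simpa using this
      rw [integral_zero, prod_atTop_atTop_eq] at hlim
      obtain ⟨⟨N₁, N₂⟩, hN⟩ := eventually_atTop.1 (hlim.eventually (gt_mem_nhds one_pos))
      refine ⟨max N₁ N₂, fun m hm n hn => hpU _ (lt_of_le_of_lt ?_ (hN (m, n)
        ⟨(le_max_left _ _).trans hm, (le_max_right _ _).trans hn⟩))⟩
      refine hτ.seminorm_le_integral (fun f _ => ?_) hp (hint m n)
      exact ((f.integral_comp_comm ((hGi m).sub (hGi n))).trans
        (congrArg f (integral_sub (hGi m) (hGi n)))).symm)
  refine ⟨z, fun f hf => ?_⟩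
  refine tendsto_nhds_unique
    (tendsto_of_mem_circDual hf (Eventually.of_forall hSb) hz) ?_
  have : ∀ n, f (S n) = ∫ s in Ioi (0 : ℝ), f (G n s) := fun n =>
    (f.integral_comp_comm (hGi n)).symm
  simp only [this]
  refine tendsto_integral_of_dominated_convergence (fun s => ‖f‖ * b s)
    (fun n => (f.continuous.comp_stronglyMeasurable (hGm n)).aestronglyMeasurable)
    (hbi.const_mul _) (fun n => Eventually.of_forall fun s => ?_) ?_
  · exact (f.le_opNorm _).trans (by gcongr; exact hGb n s)
  · filter_upwards [ae_restrict_mem measurableSet_Ioi] with s hs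
    exact tendsto_of_mem_circDual hf (Eventually.of_forall fun n => hGb n s) (hGlim s (le_of_lt hs))

end WeakIntegral

/-! ### The scalar exponential and rescaled semigroups -/

section Exponential

variable {𝕜 : Type*} [RCLike 𝕜]

/-- The scalar exponential `s ↦ exp (s μ)`, for `𝕜 = ℝ` and `𝕜 = ℂ` alike. -/
noncomputable def scalarExp (μ : 𝕜) (s : ℝ) : 𝕜 := NormedSpace.exp (s • μ)

theorem scalarExp_zero (μ : 𝕜) : scalarExp μ 0 = 1 := by simp [scalarExp]

theorem scalarExp_add (μ : 𝕜) (s t : ℝ) :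
    scalarExp μ (s + t) = scalarExp μ s * scalarExp μ t := by
  rw [scalarExp, add_smul, NormedSpace.exp_add]; rfl

theorem scalarExp_mul_neg (μ : 𝕜) (s : ℝ) : scalarExp μ s * scalarExp (-μ) s = 1 := by
  rw [scalarExp, scalarExp, ← NormedSpace.exp_add]; simp

theorem hasDerivAt_scalarExp_zero (μ : 𝕜) : HasDerivAt (scalarExp μ) μ 0 := by
  have := hasDerivAt_exp_smul_const (𝕂 := ℝ) μ 0
  simpa [scalarExp] using! this

theorem continuous_scalarExp (μ : 𝕜) : Continuous (scalarExp μ) :=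
  NormedSpace.exp_continuous.comp (continuous_id.smul continuous_const)

theorem norm_scalarExp (μ : 𝕜) (s : ℝ) : ‖scalarExp μ s‖ = Real.exp (RCLike.re μ * s) := by
  -- `|e^{sμ}|² = e^{sμ} e^{s conj μ} = e^{2 s re μ}`
  have h : ((‖scalarExp μ s‖ ^ 2 : ℝ) : 𝕜) = ((Real.exp (RCLike.re μ * s) ^ 2 : ℝ) : 𝕜) := by
    push_cast
    rw [← RCLike.conj_mul]
    have h1 : (starRingEnd 𝕜) (scalarExp μ s) = NormedSpace.exp (s • (starRingEnd 𝕜) μ) := by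
      have := NormedSpace.star_exp (s • μ)
      simpa [scalarExp] using! this
    rw [h1, scalarExp, ← NormedSpace.exp_add, ← smul_add, add_comm, RCLike.add_conj]
    have h2 : s • (2 * ((RCLike.re μ : ℝ) : 𝕜)) =
        algebraMap ℝ 𝕜 (RCLike.re μ * s + RCLike.re μ * s) := by
      rw [RCLike.real_smul_eq_coe_mul, RCLike.algebraMap_eq_ofReal]
      push_cast
      ring
    rw [h2, ← NormedSpace.algebraMap_exp_comm (𝕂 := ℝ), ← Real.exp_eq_exp_ℝ, Real.exp_add,
      RCLike.algebraMap_eq_ofReal]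
    push_cast
    ring
  have h' := RCLike.ofReal_injective h
  exact (pow_left_inj₀ (norm_nonneg _) (Real.exp_pos _).le two_ne_zero).1 h'

end Exponential

section Rescale

variable {𝕜 : Type*} [RCLike 𝕜] {X : Type*} [NormedAddCommGroup X] [NormedSpace 𝕜 X]
  {τ : Topo X}

/-- The rescaled semigroup `t ↦ exp (-μ t) T(t)`. -/
noncomputable def rescale (μ : 𝕜) (T : ℝ≥0 → X →L[𝕜] X) (t : ℝ≥0) : X →L[𝕜] X :=
  scalarExp (-μ) t • T t

theorem rescale_apply (μ : 𝕜) (T : ℝ≥0 → X →L[𝕜] X) (t : ℝ≥0) (x : X) :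
    rescale μ T t x = scalarExp (-μ) t • T t x := rfl

theorem scalarExp_smul_rescale (μ : 𝕜) (T : ℝ≥0 → X →L[𝕜] X) (t : ℝ≥0) (x : X) :
    scalarExp μ t • rescale μ T t x = T t x := by
  rw [rescale_apply, smul_smul, scalarExp_mul_neg, one_smul]

theorem norm_rescale_le (μ : 𝕜) {T : ℝ≥0 → X →L[𝕜] X} {M ω : ℝ}
    (hM : ∀ t : ℝ≥0, ‖T t‖ ≤ M * Real.exp (ω * t)) (t : ℝ≥0) :
    ‖rescale μ T t‖ ≤ M * Real.exp (-(RCLike.re μ - ω) * t) := by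
  rw [rescale, norm_smul, norm_scalarExp]
  calc Real.exp (RCLike.re (-μ) * t) * ‖T t‖
      ≤ Real.exp (RCLike.re (-μ) * t) * (M * Real.exp (ω * t)) := by gcongr; exact hM t
    _ = M * (Real.exp (RCLike.re (-μ) * t) * Real.exp (ω * t)) := by ring
    _ = _ := by
      rw [← Real.exp_add, map_neg]
      congr 2
      ring

theorem IsContSeminorm.lt_mem_nhds {p : Seminorm 𝕜 X} (hp : IsContSeminorm τ p)
    {r : ℝ} (hr : 0 < r) : {x | p x < r} ∈ @nhds X τ.top 0 := by
  let := τ.top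
  have h : Tendsto p (𝓝 0) (𝓝 (p 0)) := Continuous.tendsto hp 0
  exact h.eventually (gt_mem_nhds (by rwa [map_zero]))

variable [NormedSpace ℝ X] (hτ : IsStandardTriple 𝕜 τ)
include hτ

theorem IsStandardTriple.isBiContinuous_rescale [IsScalarTower ℝ 𝕜 X] {T : ℝ≥0 → X →L[𝕜] X}
    (hT : IsBiContinuous τ T) (μ : 𝕜) : IsBiContinuous τ (rescale μ T) where
  zero := by
    ext x
    simp [rescale_apply, scalarExp_zero, hT.zero]
  add t s := by
    ext x
    simp only [rescale_apply, NNReal.coe_add, scalarExp_add, hT.add, ContinuousLinearMap.comp_apply,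
      map_smul, smul_smul, mul_comm]
  strong x := by
    let := τ.top
    have := hτ.linear.smul
    exact ((continuous_scalarExp (-μ)).comp NNReal.continuous_coe).smul (hT.strong x)
  expBounded := by
    obtain ⟨M, hM1, ω, hM⟩ := hT.expBounded
    exact ⟨M, hM1, _, norm_rescale_le μ hM⟩
  biEquicontinuous u x hu hx t₀ U hU := by
    obtain ⟨p, hp, hpU⟩ := hτ.exists_seminorm_ball_subset hU
    have hK : 0 < Real.exp (-(|RCLike.re μ| * t₀)) := Real.exp_pos _
    filter_upwards [hT.biEquicontinuous u x hu hx t₀ _ (hp.lt_mem_nhds hK)]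
      with n hn t ht
    refine hpU _ ?_
    rw [rescale_apply, map_smul_eq_mul, norm_scalarExp]
    calc Real.exp (RCLike.re (-μ) * t) * p (T t (u n - x))
        < Real.exp (RCLike.re (-μ) * t) * Real.exp (-(|RCLike.re μ| * t₀)) := by
          gcongr; exact hn t ht
      _ ≤ 1 := by
          rw [← Real.exp_add, Real.exp_le_one_iff, map_neg]
          have h1 : -RCLike.re μ * (t : ℝ) ≤ |RCLike.re μ| * t :=
            mul_le_mul_of_nonneg_right (neg_le_abs _) t.2
          have h2 : |RCLike.re μ| * (t : ℝ) ≤ |RCLike.re μ| * t₀ :=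
            mul_le_mul_of_nonneg_left (NNReal.coe_le_coe.2 ht) (abs_nonneg _)
          linarith

end Rescale

/-! ### Sequential continuity on norm bounded sets -/

section SeqCont

variable {𝕜 : Type*} [RCLike 𝕜] {X : Type*} [NormedAddCommGroup X] [NormedSpace 𝕜 X]
  {τ : Topo X}

/-- `S` is `τ`-sequentially continuous on norm bounded sets. -/
def IsBddSeqContinuous (τ : Topo X) (S : X →L[𝕜] X) : Prop :=
  ∀ (u : ℕ → X) (x : X), Bornology.IsBounded (range u) → τ.Lim u atTop x →
    τ.Lim (fun n => S (u n)) atTop (S x)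

theorem IsBddSeqContinuous.dualOp_mem {S : X →L[𝕜] X} (hS : IsBddSeqContinuous τ S)
    {f : StrongDual 𝕜 X} (hf : f ∈ circDual 𝕜 τ) : dualOp S f ∈ circDual 𝕜 τ := by
  intro u x hu hx
  obtain ⟨C, hC⟩ := isBounded_iff_forall_norm_le.1 hu
  exact tendsto_of_mem_circDual hf (C := ‖S‖ * C) (Eventually.of_forall fun n =>
    (S.le_opNorm _).trans (by gcongr; exact hC _ (mem_range_self n))) (hS u x hu hx)

theorem IsBddSeqContinuous.lim {S : X →L[𝕜] X} (hS : IsBddSeqContinuous τ S) {ι : Type*}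
    {u : ι → X} {l : Filter ι} [l.IsCountablyGenerated] {x : X} {C : ℝ}
    (hC : ∀ᶠ i in l, ‖u i‖ ≤ C) (hu : τ.Lim u l x) : τ.Lim (fun i => S (u i)) l (S x) := by
  refine tendsto_of_seq_tendsto fun v hv => ?_
  obtain ⟨N, hN⟩ := eventually_atTop.1 (hv.eventually hC)
  rw [← tendsto_add_atTop_iff_nat N]
  refine hS (fun n => u (v (n + N))) x ?_ ?_
  · exact isBounded_iff_forall_norm_le.2 ⟨C, by rintro _ ⟨n, rfl⟩; exact hN _ (by omega)⟩
  · exact Tendsto.comp hu (hv.comp (tendsto_add_atTop_nat N))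

theorem IsBiContinuous.isBddSeqContinuous (hτ : IsVectorTopology 𝕜 τ) {T : ℝ≥0 → X →L[𝕜] X}
    (hT : IsBiContinuous τ T) (t : ℝ≥0) : IsBddSeqContinuous τ (T t) := by
  intro u x hu hx
  have h : Tendsto (fun n => T t (u n - x)) atTop (@nhds X τ.top 0) := fun U hU =>
    (hT.biEquicontinuous u x hu hx t U hU).mono fun n hn => hn t le_rfl
  let := τ.top
  have := hτ.addGroup
  have h2 := h.add (tendsto_const_nhds (x := T t x))
  change Tendsto _ _ (@nhds X τ.top _)
  simpa [map_sub] using h2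

end SeqCont

/-! ### The Laplace transform -/

section Laplace

variable {𝕜 : Type*} [RCLike 𝕜] {X : Type*} [NormedAddCommGroup X] [NormedSpace 𝕜 X]
  {τ : Topo X} {T : ℝ≥0 → X →L[𝕜] X}

/-- `R x` is the integral of the orbit `s ↦ T(s) x` over `(0, ∞)`, weakly against `X°`. -/
def IsOrbitIntegral (τ : Topo X) (T : ℝ≥0 → X →L[𝕜] X) (R : X →L[𝕜] X) : Prop :=
  ∀ x, ∀ f ∈ circDual 𝕜 τ, f (R x) = ∫ s in Ioi (0 : ℝ), f (T s.toNNReal x)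

theorem IsBiContinuous.lim_orbit (hT : IsBiContinuous τ T) (x : X) (s : ℝ) :
    τ.Lim (fun s : ℝ => T s.toNNReal x) (𝓝 s) (T s.toNNReal x) := by
  let := τ.top
  exact ((hT.strong x).comp continuous_real_toNNReal).tendsto s

theorem IsBiContinuous.continuous_seminorm_orbit (hT : IsBiContinuous τ T) {p : Seminorm 𝕜 X}
    (hp : IsContSeminorm τ p) (x : X) : Continuous fun s : ℝ => p (T s.toNNReal x) := by
  let := τ.top
  exact Continuous.comp hp ((hT.strong x).comp continuous_real_toNNReal)

theorem norm_orbit_le {M ω : ℝ} (hM : ∀ t : ℝ≥0, ‖T t‖ ≤ M * Real.exp (ω * t)) (x : X)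
    {s : ℝ} (hs : 0 ≤ s) : ‖T s.toNNReal x‖ ≤ M * ‖x‖ * Real.exp (ω * s) := by
  refine ((T _).le_of_opNorm_le (hM _) x).trans_eq ?_
  rw [Real.coe_toNNReal s hs]
  ring

theorem IsBiContinuous.continuous_circDual_orbit (hT : IsBiContinuous τ T) {f : StrongDual 𝕜 X}
    (hf : f ∈ circDual 𝕜 τ) (x : X) : Continuous fun s : ℝ => f (T s.toNNReal x) := by
  obtain ⟨M, -, ω, hM⟩ := hT.expBounded
  refine continuous_of_mem_circDual hf (hT.lim_orbit x)
    (C := fun s => M * Real.exp (ω * s.toNNReal) * ‖x‖) ?_ fun s =>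
    (T _).le_of_opNorm_le (hM _) x
  have := NNReal.continuous_coe.comp continuous_real_toNNReal
  exact ((continuous_const.mul (Real.continuous_exp.comp (continuous_const.mul this))).mul
    continuous_const)

theorem integrableOn_circDual_orbit (hT : IsBiContinuous τ T) {M ε : ℝ} (hε : 0 < ε)
    (hM : ∀ t : ℝ≥0, ‖T t‖ ≤ M * Real.exp (-ε * t)) {f : StrongDual 𝕜 X}
    (hf : f ∈ circDual 𝕜 τ) (x : X) :
    IntegrableOn (fun s : ℝ => f (T s.toNNReal x)) (Ioi 0) := by
  refine Integrable.mono' (((exp_neg_integrableOn_Ioi 0 hε).const_mul (M * ‖x‖)).const_mul ‖f‖)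
    (hT.continuous_circDual_orbit hf x).aestronglyMeasurable ?_
  filter_upwards [ae_restrict_mem measurableSet_Ioi] with s hs
  refine (f.le_opNorm _).trans ?_
  gcongr
  exact norm_orbit_le hM x (le_of_lt hs)

variable [NormedSpace ℝ X] (hτ : IsStandardTriple 𝕜 τ)
include hτ

theorem IsStandardTriple.integrableOn_exp_mul_seminorm_orbit (hT : IsBiContinuous τ T)
    {p : Seminorm 𝕜 X} (hp : IsContSeminorm τ p) {M ω α : ℝ} (hα : ω < α)
    (hM : ∀ t : ℝ≥0, ‖T t‖ ≤ M * Real.exp (ω * t)) (x : X) :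
    IntegrableOn (fun s : ℝ => Real.exp (-α * s) * p (T s.toNNReal x)) (Ioi 0) := by
  obtain ⟨K, hK0, hK⟩ := hτ.exists_seminorm_bound hp
  refine Integrable.mono' (((exp_neg_integrableOn_Ioi 0 (sub_pos.2 hα)).const_mul
    (K * (M * ‖x‖))))
    ((Real.continuous_exp.comp (continuous_const.mul continuous_id)).mul
      (hT.continuous_seminorm_orbit hp x)).aestronglyMeasurable ?_
  filter_upwards [ae_restrict_mem measurableSet_Ioi] with s hs
  rw [Real.norm_of_nonneg (mul_nonneg (Real.exp_pos _).le (apply_nonneg p _))]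
  calc Real.exp (-α * s) * p (T s.toNNReal x)
      ≤ Real.exp (-α * s) * (K * (M * ‖x‖ * Real.exp (ω * s))) := by
        gcongr
        exact (hK _).trans (by gcongr; exact norm_orbit_le hM x (le_of_lt hs))
    _ = K * (M * ‖x‖) * (Real.exp (-α * s) * Real.exp (ω * s)) := by ring
    _ = _ := by
        rw [← Real.exp_add]
        congr 2
        ring

/-- The orbit integral commutes with the semigroup. -/
theorem IsStandardTriple.orbitIntegral_comm (hT : IsBiContinuous τ T) {R : X →L[𝕜] X}
    (hR : IsOrbitIntegral τ T R) (t : ℝ≥0) (x : X) : R (T t x) = T t (R x) := by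
  refine hτ.eq_of_circDual fun f hf => ?_
  have h := hR x _ ((hT.isBddSeqContinuous hτ.linear t).dualOp_mem hf)
  change f (T t (R x)) = ∫ s in Ioi (0 : ℝ), f (T t (T s.toNNReal x)) at h
  rw [h, hR _ f hf]
  simp only [← ContinuousLinearMap.comp_apply, ← hT.add, add_comm]

/-- Since `T(t)` shifts the orbit, applying `1 - T(t)` to its integral over `(0, ∞)` leaves the
integral over `(0, t]`. The dual of `T(t)` has to preserve the class of test functionals here, which
is the reason for testing with `X°`. -/
theorem IsStandardTriple.orbitIntegral_sub (hT : IsBiContinuous τ T) {R : X →L[𝕜] X}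
    (hR : IsOrbitIntegral τ T R) {M ε : ℝ} (hε : 0 < ε)
    (hM : ∀ t : ℝ≥0, ‖T t‖ ≤ M * Real.exp (-ε * t)) (t : ℝ≥0) (x : X) {f : StrongDual 𝕜 X}
    (hf : f ∈ circDual 𝕜 τ) :
    f (R x - T t (R x)) = ∫ s in Ioc (0 : ℝ) t, f (T s.toNNReal x) := by
  have hint := integrableOn_circDual_orbit hT hε hM hf x
  have h := hR x _ ((hT.isBddSeqContinuous hτ.linear t).dualOp_mem hf)
  change f (T t (R x)) = ∫ s in Ioi (0 : ℝ), f (T t (T s.toNNReal x)) at h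
  have h2 : ∫ s in Ioi (0 : ℝ), f (T t (T s.toNNReal x)) =
      ∫ s in Ioi (t : ℝ), f (T s.toNNReal x) := by
    have hsub := (measurePreserving_add_left volume (t : ℝ)).setIntegral_preimage_emb
      (measurableEmbedding_addLeft _) (fun s => f (T s.toNNReal x)) (Ioi (t : ℝ))
    rw [show (fun s : ℝ => (t : ℝ) + s) ⁻¹' Ioi (t : ℝ) = Ioi 0 by ext; simp] at hsub
    rw [← hsub]
    refine setIntegral_congr_fun measurableSet_Ioi fun s hs => ?_
    have hs' : (0 : ℝ) ≤ s := le_of_lt hs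
    change _ = f (T ((t : ℝ) + s).toNNReal x)
    rw [Real.toNNReal_add t.coe_nonneg hs', Real.toNNReal_coe, hT.add,
      ContinuousLinearMap.comp_apply]
  have hsplit := setIntegral_union (Ioc_disjoint_Ioi_same (a := (0 : ℝ)) (b := t))
    measurableSet_Ioi (hint.mono_set Ioc_subset_Ioi_self)
    (hint.mono_set (Ioi_subset_Ioi t.coe_nonneg))
  rw [Ioc_union_Ioi_eq_Ioi t.coe_nonneg] at hsplit
  rw [map_sub, h, h2, hR x f hf, hsplit, add_sub_cancel_right]

variable [IsScalarTower ℝ 𝕜 X]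

theorem IsStandardTriple.exists_isOrbitIntegral [CompleteSpace X] (hT : IsBiContinuous τ T)
    {M ε : ℝ} (hε : 0 < ε) (hM : ∀ t : ℝ≥0, ‖T t‖ ≤ M * Real.exp (-ε * t)) :
    ∃ R : X →L[𝕜] X, IsOrbitIntegral τ T R := by
  have h : ∀ x, ∃ z, ∀ f ∈ circDual 𝕜 τ, f z = ∫ s in Ioi (0 : ℝ), f (T s.toNNReal x) := fun x =>
    hτ.exists_integral_Ioi (hT.lim_orbit x) hε fun s hs => norm_orbit_le hM x hs
  choose R hR using h
  let L : X →ₗ[𝕜] X :=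
    { toFun := R
      map_add' := fun x y => hτ.eq_of_circDual fun f hf => by
        rw [map_add, hR _ f hf, hR _ f hf, hR _ f hf,
          ← integral_add (integrableOn_circDual_orbit hT hε hM hf x)
            (integrableOn_circDual_orbit hT hε hM hf y)]
        simp only [map_add]
      map_smul' := fun c x => hτ.eq_of_circDual fun f hf => by
        rw [RingHom.id_apply, map_smul, hR _ f hf, hR _ f hf, ← integral_smul]
        simp only [map_smul] }
  refine ⟨L.mkContinuous (M * ∫ s in Ioi (0 : ℝ), Real.exp (-ε * s)) fun x => ?_, hR⟩
  have := hτ.norm_le_integral (hR x) ((exp_neg_integrableOn_Ioi 0 hε).const_mul (M * ‖x‖)) (by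
    filter_upwards [ae_restrict_mem measurableSet_Ioi] with s hs
    exact norm_orbit_le hM x (le_of_lt hs))
  rw [integral_const_mul] at this
  exact this.trans_eq (by ring)

/-- A Laplace transform at `μ` is dominated, in every seminorm, by the real Laplace transform at
any `α ≤ re μ`; the bound does not involve `μ`. -/
theorem IsStandardTriple.seminorm_laplace_le (hT : IsBiContinuous τ T) {μ : 𝕜} {R : X →L[𝕜] X}
    (hR : IsOrbitIntegral τ (rescale μ T) R) {M ω α : ℝ} (hωα : ω < α) (hα : α ≤ RCLike.re μ)
    (hM : ∀ t : ℝ≥0, ‖T t‖ ≤ M * Real.exp (ω * t)) {p : Seminorm 𝕜 X}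
    (hp : IsContSeminorm τ p) (x : X) :
    p (R x) ≤ ∫ s in Ioi (0 : ℝ), Real.exp (-α * s) * p (T s.toNNReal x) := by
  have hle : ∀ s : ℝ, 0 < s → p (rescale μ T s.toNNReal x) ≤
      Real.exp (-α * s) * p (T s.toNNReal x) := fun s hs => by
    rw [rescale_apply, map_smul_eq_mul, norm_scalarExp, Real.coe_toNNReal s hs.le, map_neg]
    gcongr
  have hi := hτ.integrableOn_exp_mul_seminorm_orbit hT hp hωα hM x
  have hi' : IntegrableOn (fun s : ℝ => p (rescale μ T s.toNNReal x)) (Ioi 0) := by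
    refine Integrable.mono' hi
      ((hτ.isBiContinuous_rescale hT μ).continuous_seminorm_orbit hp x).aestronglyMeasurable ?_
    filter_upwards [ae_restrict_mem measurableSet_Ioi] with s hs
    rw [Real.norm_of_nonneg (apply_nonneg p _)]
    exact hle s hs
  exact (hτ.seminorm_le_integral (hR x) hp hi').trans
    (setIntegral_mono_on hi' hi measurableSet_Ioi fun s hs => hle s hs)

/-- The real Laplace transforms of a bounded `τ`-null sequence tend to zero. -/
theorem IsStandardTriple.tendsto_integral_seminorm_orbit (hT : IsBiContinuous τ T)
    {M ω α : ℝ} (hωα : ω < α) (hM : ∀ t : ℝ≥0, ‖T t‖ ≤ M * Real.exp (ω * t))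
    {p : Seminorm 𝕜 X} (hp : IsContSeminorm τ p) {u : ℕ → X} {x : X}
    (hu : Bornology.IsBounded (range u)) (hx : τ.Lim u atTop x) :
    Tendsto (fun n => ∫ s in Ioi (0 : ℝ), Real.exp (-α * s) * p (T s.toNNReal (u n - x)))
      atTop (𝓝 0) := by
  obtain ⟨K, hK0, hK⟩ := hτ.exists_seminorm_bound hp
  obtain ⟨C, hC⟩ := isBounded_iff_forall_norm_le.1 hu
  have hM0 : 0 ≤ M := by simpa using (norm_nonneg _).trans (hM 0)
  have hC' : ∀ n, ‖u n - x‖ ≤ C + ‖x‖ := fun n =>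
    (norm_sub_le _ _).trans (by gcongr; exact hC _ (mem_range_self n))
  suffices h : Tendsto
      (fun n => ∫ s in Ioi (0 : ℝ), Real.exp (-α * s) * p (T s.toNNReal (u n - x)))
      atTop (𝓝 (∫ s in Ioi (0 : ℝ), (0 : ℝ))) by rwa [integral_zero] at h
  refine tendsto_integral_of_dominated_convergence
    (fun s => K * (M * (C + ‖x‖)) * Real.exp (-(α - ω) * s))
    (fun n => (hτ.integrableOn_exp_mul_seminorm_orbit hT hp hωα hM _).aestronglyMeasurable)
    ((exp_neg_integrableOn_Ioi 0 (sub_pos.2 hωα)).const_mul _) (fun n => ?_) ?_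
  · filter_upwards [ae_restrict_mem measurableSet_Ioi] with s hs
    rw [Real.norm_of_nonneg (mul_nonneg (Real.exp_pos _).le (apply_nonneg p _))]
    calc Real.exp (-α * s) * p (T s.toNNReal (u n - x))
        ≤ Real.exp (-α * s) * (K * (M * (C + ‖x‖) * Real.exp (ω * s))) := by
          gcongr
          refine (hK _).trans ?_
          gcongr
          refine (norm_orbit_le hM _ (le_of_lt hs)).trans ?_
          gcongr
          exact hC' n
      _ = K * (M * (C + ‖x‖)) * (Real.exp (-α * s) * Real.exp (ω * s)) := by ring
      _ = _ := by
          rw [← Real.exp_add]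
          congr 2
          ring
  · refine Eventually.of_forall fun s => ?_
    have h := hτ.lim_iff.1 (hT.isBddSeqContinuous hτ.linear s.toNNReal u x hu hx) p hp
    simpa using h.const_mul (Real.exp (-α * s))

theorem IsStandardTriple.isBddSeqContinuous_laplace (hT : IsBiContinuous τ T) {μ : 𝕜}
    {R : X →L[𝕜] X} (hR : IsOrbitIntegral τ (rescale μ T) R) {M ω : ℝ} (hω : ω < RCLike.re μ)
    (hM : ∀ t : ℝ≥0, ‖T t‖ ≤ M * Real.exp (ω * t)) : IsBddSeqContinuous τ R := by
  intro u x hu hx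
  refine hτ.lim_iff.2 fun p hp => squeeze_zero (fun _ => apply_nonneg p _) (fun n => ?_)
    (hτ.tendsto_integral_seminorm_orbit hT hω hM hp hu hx)
  rw [← map_sub]
  exact hτ.seminorm_laplace_le hT hR hω le_rfl hM hp _

end Laplace

/-! ### Generators and resolvents -/

section Generator

variable {𝕜 : Type*} [RCLike 𝕜] {Y : Type*} [NormedAddCommGroup Y] [NormedSpace 𝕜 Y]
  {σ : Topo Y} {T : ℝ≥0 → Y →L[𝕜] Y}

theorem norm_diffQuot (T : ℝ≥0 → Y →L[𝕜] Y) (x : Y) (t : ℝ≥0) :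
    ‖diffQuot T x t‖ = ‖T t x - x‖ / t := by
  rw [diffQuot, norm_smul, norm_inv, RCLike.norm_ofReal, abs_of_nonneg t.coe_nonneg,
    div_eq_inv_mul]

theorem eventually_mem_Ioc_zero_one : ∀ᶠ t : ℝ≥0 in 𝓝[>] 0, 0 < t ∧ t ≤ 1 := by
  filter_upwards [self_mem_nhdsWithin, mem_nhdsWithin_of_mem_nhds (Iic_mem_nhds one_pos)]
    with t h0 h1 using ⟨h0, h1⟩

theorem generator_lim (hσ : IsVectorTopology 𝕜 σ) (hσ₂ : @T2Space Y σ.top)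
    (x : (generator σ hσ hσ₂ T).domain) :
    σ.Lim (diffQuot T x) (𝓝[>] 0) (generator σ hσ hσ₂ T x) :=
  Classical.choose_spec (And.left x.2)

theorem generator_eq (hσ : IsVectorTopology 𝕜 σ) (hσ₂ : @T2Space Y σ.top)
    (x : (generator σ hσ hσ₂ T).domain) {y : Y} (h : σ.Lim (diffQuot T x) (𝓝[>] 0) y) :
    generator σ hσ hσ₂ T x = y :=
  @tendsto_nhds_unique _ _ σ.top hσ₂ _ _ _ _ _ (generator_lim hσ hσ₂ x) h

variable {A : Y →ₗ.[𝕜] Y} {μ : 𝕜}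

theorem resolvent_apply_sub (hμ : μ ∈ resolventSet A) (x : A.domain) :
    resolvent A μ (μ • (x : Y) - A x) = x := by
  rw [resolvent, dif_pos hμ]
  exact Classical.choose_spec hμ.2 x

/-- The resolvent maps into the domain, and is a right inverse of `μ - A`. -/
theorem exists_resolvent_eq (hμ : μ ∈ resolventSet A) (y : Y) :
    ∃ x : A.domain, resolvent A μ y = x ∧ μ • (x : Y) - A x = y := by
  obtain ⟨x, hx⟩ := hμ.1.2 y
  exact ⟨x, by rw [← resolvent_apply_sub hμ x]; exact congrArg _ hx.symm, hx⟩

theorem mem_resolventSet_of_inverse {R : Y →L[𝕜] Y}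
    (hl : ∀ x : A.domain, R (μ • (x : Y) - A x) = x)
    (hr : ∀ y, ∃ x : A.domain, μ • (x : Y) - A x = y) :
    μ ∈ resolventSet A ∧ resolvent A μ = R := by
  have h : μ ∈ resolventSet A := by
    refine ⟨⟨fun x y hxy => Subtype.ext ?_, hr⟩, R, hl⟩
    rw [← hl x, ← hl y]
    exact congrArg R hxy
  refine ⟨h, ContinuousLinearMap.ext fun y => ?_⟩
  obtain ⟨x, rfl⟩ := hr y
  rw [resolvent_apply_sub h, hl]

theorem exists_lt_of_growthBound_lt {T : ℝ≥0 → Y →L[𝕜] Y} {α : ℝ}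
    (h : growthBound T < (α : EReal)) :
    ∃ ω < α, ∃ M : ℝ, ∀ t : ℝ≥0, ‖T t‖ ≤ M * Real.exp (ω * t) := by
  obtain ⟨_, ⟨ω, ⟨M, -, hM⟩, rfl⟩, hω⟩ := sInf_lt_iff.1 h
  exact ⟨ω, EReal.coe_lt_coe_iff.1 hω, M, hM⟩

end Generator

section BiContinuous

variable {𝕜 : Type*} [RCLike 𝕜] {X : Type*} [NormedAddCommGroup X] [NormedSpace 𝕜 X]
  {τ : Topo X} {T : ℝ≥0 → X →L[𝕜] X}

/-- The difference quotients of `T` and of its rescaling differ by the difference quotients of the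
scalar exponential. -/
theorem diffQuot_eq_rescale (μ : 𝕜) (T : ℝ≥0 → X →L[𝕜] X) (z : X) {t : ℝ≥0} (ht : 0 < t) :
    diffQuot T z t =
      scalarExp μ t • diffQuot (rescale μ T) z t + dslope (scalarExp μ) 0 (t : ℝ) • z := by
  have ht' : (t : ℝ) ≠ 0 := NNReal.coe_ne_zero.2 ht.ne'
  rw [dslope_of_ne _ ht', slope_def_module, sub_zero, scalarExp_zero, diffQuot, diffQuot,
    smul_comm (scalarExp μ (t : ℝ)), RCLike.real_smul_eq_coe_mul, mul_smul, RCLike.ofReal_inv,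
    ← smul_add, smul_sub (scalarExp μ (t : ℝ)), scalarExp_smul_rescale, sub_smul, one_smul]
  congr 1
  abel

theorem continuous_dslope_scalarExp (μ : 𝕜) : Continuous (dslope (scalarExp μ) (0 : ℝ)) := by
  rw [continuous_iff_continuousAt]
  intro s
  by_cases hs : s = 0
  · subst hs
    exact continuousAt_dslope_same.2 (hasDerivAt_scalarExp_zero μ).differentiableAt
  · exact (continuousAt_dslope_of_ne hs).2 (continuous_scalarExp μ).continuousAt

theorem generator_apply_semigroup (hσ : IsVectorTopology 𝕜 τ) (hσ₂ : @T2Space X τ.top)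
    (hT : IsBiContinuous τ T) (t : ℝ≥0) (x : (generator τ hσ hσ₂ T).domain) :
    ∃ y : (generator τ hσ hσ₂ T).domain, (y : X) = T t x ∧
      generator τ hσ hσ₂ T y = T t (generator τ hσ hσ₂ T x) := by
  obtain ⟨C, hC⟩ := x.2.2
  have hcomm : ∀ h : ℝ≥0, T h (T t x) = T t (T h x) := fun h => by
    rw [← ContinuousLinearMap.comp_apply, ← hT.add, add_comm, hT.add,
      ContinuousLinearMap.comp_apply]
  have hd : diffQuot T (T t (x : X)) = fun h => T t (diffQuot T x h) := by
    funext h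
    rw [diffQuot, diffQuot, map_smul, map_sub, hcomm]
  have hlim : τ.Lim (diffQuot T (T t (x : X))) (𝓝[>] 0) (T t (generator τ hσ hσ₂ T x)) := by
    rw [hd]
    refine (hT.isBddSeqContinuous hσ t).lim (C := C) ?_ (generator_lim hσ hσ₂ x)
    filter_upwards [eventually_mem_Ioc_zero_one] with h hh
    rw [norm_diffQuot]
    exact hC h hh.1 hh.2
  have hmem : T t (x : X) ∈ (generator τ hσ hσ₂ T).domain := by
    refine ⟨⟨_, hlim⟩, ‖T t‖ * C, fun h h0 h1 => ?_⟩
    rw [hcomm, ← map_sub]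
    refine le_trans ?_ (mul_le_mul_of_nonneg_left (hC h h0 h1) (norm_nonneg _))
    rw [← mul_div_assoc]
    gcongr
    exact (T t).le_opNorm _
  exact ⟨⟨_, hmem⟩, rfl, generator_eq hσ hσ₂ ⟨_, hmem⟩ hlim⟩

/-- The resolvent of the generator commutes with the semigroup. -/
theorem resolvent_generator_comm (hσ : IsVectorTopology 𝕜 τ) (hσ₂ : @T2Space X τ.top)
    (hT : IsBiContinuous τ T) {μ : 𝕜} (hμ : μ ∈ resolventSet (generator τ hσ hσ₂ T)) (t : ℝ≥0)
    (x : X) :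
    resolvent (generator τ hσ hσ₂ T) μ (T t x) = T t (resolvent (generator τ hσ hσ₂ T) μ x) := by
  obtain ⟨z, hz, hzx⟩ := exists_resolvent_eq hμ x
  obtain ⟨y, hy, hyz⟩ := generator_apply_semigroup hσ hσ₂ hT t z
  rw [hz, ← hy, ← resolvent_apply_sub hμ y, hyz, hy, ← map_smul, ← map_sub, hzx]

variable [NormedSpace ℝ X] (hτ : IsStandardTriple 𝕜 τ)
include hτ

/-- An orbit integral `R x` has a bounded difference quotient. -/
theorem IsStandardTriple.norm_orbitIntegral_sub_le (hT : IsBiContinuous τ T) {R : X →L[𝕜] X}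
    (hR : IsOrbitIntegral τ T R) {M ε : ℝ} (hε : 0 < ε)
    (hM : ∀ t : ℝ≥0, ‖T t‖ ≤ M * Real.exp (-ε * t)) (x : X) (t : ℝ≥0) :
    ‖T t (R x) - R x‖ ≤ M * ‖x‖ * t := by
  have hM0 : 0 ≤ M := by simpa using (norm_nonneg _).trans (hM 0)
  have h := hτ.norm_le_integral (ν := volume.restrict (Ioc (0 : ℝ) t)) (b := fun _ => M * ‖x‖)
    (fun f hf => hτ.orbitIntegral_sub hT hR hε hM t x hf) (integrable_const _) (by
      filter_upwards [ae_restrict_mem measurableSet_Ioc] with s hs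
      refine (norm_orbit_le hM x hs.1.le).trans (mul_le_of_le_one_right (by positivity) ?_)
      rw [Real.exp_le_one_iff]
      nlinarith [hs.1])
  rw [norm_sub_rev]
  refine h.trans_eq ?_
  simp [mul_comm]

variable [IsScalarTower ℝ 𝕜 X]

/-- For an exponentially decaying semigroup, `(T(t) - 1) ∫₀^∞ T(s) x ds / t → -x`. -/
theorem IsStandardTriple.lim_diffQuot_orbitIntegral (hT : IsBiContinuous τ T) {R : X →L[𝕜] X}
    (hR : IsOrbitIntegral τ T R) {M ε : ℝ} (hε : 0 < ε)
    (hM : ∀ t : ℝ≥0, ‖T t‖ ≤ M * Real.exp (-ε * t)) (x : X) :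
    τ.Lim (diffQuot T (R x)) (𝓝[>] 0) (-x) := by
  refine hτ.lim_iff.2 fun p hp => ?_
  have hcont : Continuous fun s : ℝ => p (T s.toNNReal x - x) := by
    let := τ.top
    have := hτ.linear.addGroup
    exact Continuous.comp hp (((hT.strong x).comp continuous_real_toNNReal).sub continuous_const)
  have h0 : p (T (0 : ℝ).toNNReal x - x) = 0 := by simp [hT.zero]
  rw [Metric.tendsto_nhds]
  intro δ hδ
  have hev : ∀ᶠ s : ℝ in 𝓝 0, p (T s.toNNReal x - x) < δ / 2 :=
    hcont.continuousAt.eventually (gt_mem_nhds (by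
      change p (T (0 : ℝ).toNNReal x - x) < δ / 2
      rw [h0]
      positivity))
  obtain ⟨r, hr, hrs⟩ := Metric.eventually_nhds_iff.1 hev
  have hr' : ∀ᶠ t : ℝ≥0 in 𝓝[>] 0, (t : ℝ) < r :=
    mem_nhdsWithin_of_mem_nhds (NNReal.continuous_coe.continuousAt.eventually (gt_mem_nhds hr))
  filter_upwards [self_mem_nhdsWithin, hr'] with t ht htr
  have ht0 : (0 : ℝ) < t := ht
  have hle : p (R x - T t (R x) - ((t : ℝ) : 𝕜) • x) ≤ ∫ _ in Ioc (0 : ℝ) t, δ / 2 := by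
    have hi : IntegrableOn (fun s : ℝ => p (T s.toNNReal x - x)) (Ioc 0 (t : ℝ)) :=
      (hcont.integrableOn_Icc).mono_set Ioc_subset_Icc_self
    refine (hτ.seminorm_le_integral (fun f hf => ?_) hp hi).trans
      (setIntegral_mono_on hi (integrable_const _) measurableSet_Ioc fun s hs => ?_)
    · have h1 : IntegrableOn (fun s : ℝ => f (T s.toNNReal x)) (Ioc 0 (t : ℝ)) :=
        ((hT.continuous_circDual_orbit hf x).integrableOn_Icc).mono_set Ioc_subset_Icc_self
      have h2 : IntegrableOn (fun _ : ℝ => f x) (Ioc 0 (t : ℝ)) := integrable_const _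
      have h3 := integral_sub h1 h2
      rw [map_sub, hτ.orbitIntegral_sub hT hR hε hM t x hf]
      simp only [map_sub]
      rw [h3]
      simp [RCLike.real_smul_eq_coe_mul]
    · refine (hrs ?_).le
      rw [Real.dist_0_eq_abs, abs_of_pos hs.1]
      exact hs.2.trans_lt htr
  have heq : diffQuot T (R x) t - -x =
      -((((t : ℝ) : 𝕜)⁻¹) • (R x - T t (R x) - ((t : ℝ) : 𝕜) • x)) := by
    have : (((t : ℝ) : 𝕜)) ≠ 0 := RCLike.ofReal_ne_zero.2 ht0.ne'
    rw [diffQuot, smul_sub _ (R x - T t (R x)), smul_smul, inv_mul_cancel₀ this, one_smul,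
      ← neg_sub (R x) (T t (R x)), smul_neg]
    abel
  rw [Real.dist_0_eq_abs, abs_of_nonneg (apply_nonneg p _), heq, map_neg_eq_map,
    map_smul_eq_mul, norm_inv, RCLike.norm_ofReal, abs_of_pos ht0, inv_mul_lt_iff₀ ht0]
  refine hle.trans_lt ?_
  simp
  nlinarith

/-- The Laplace transform of a bi-continuous semigroup at `μ` is a right inverse of `μ - A`. -/
theorem IsStandardTriple.exists_generator_laplace (hT : IsBiContinuous τ T) {μ : 𝕜}
    {R : X →L[𝕜] X} (hR : IsOrbitIntegral τ (rescale μ T) R) {M ω : ℝ} (hω : ω < RCLike.re μ)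
    (hM : ∀ t : ℝ≥0, ‖T t‖ ≤ M * Real.exp (ω * t)) (x : X) :
    ∃ z : (generator τ hτ.linear hτ.t2 T).domain, (z : X) = R x ∧
      generator τ hτ.linear hτ.t2 T z = μ • R x - x := by
  have hU := hτ.isBiContinuous_rescale hT μ
  have hε := sub_pos.2 hω
  have hMU := norm_rescale_le μ hM
  have hM0 : 0 ≤ M := by simpa using (norm_nonneg _).trans (hM 0)
  have hlimU := hτ.lim_diffQuot_orbitIntegral hU hR hε hMU x
  have hcoe : Tendsto (fun t : ℝ≥0 => (t : ℝ)) (𝓝[>] 0) (𝓝 0) :=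
    (NNReal.continuous_coe.tendsto 0).mono_left nhdsWithin_le_nhds
  have hlim : τ.Lim (diffQuot T (R x)) (𝓝[>] 0) (μ • R x - x) := by
    let := τ.top
    have := hτ.linear.addGroup
    have := hτ.linear.smul
    have h1 : Tendsto (fun t : ℝ≥0 => scalarExp μ t) (𝓝[>] 0) (𝓝 1) := by
      rw [← scalarExp_zero μ]
      exact ((continuous_scalarExp μ).tendsto 0).comp hcoe
    have h2 : Tendsto (fun t : ℝ≥0 => dslope (scalarExp μ) 0 (t : ℝ)) (𝓝[>] 0) (𝓝 μ) := by
      have := ((continuous_dslope_scalarExp μ).tendsto 0).comp hcoe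
      rwa [dslope_same, (hasDerivAt_scalarExp_zero μ).deriv] at this
    have h3 := (h1.smul (show Tendsto _ _ (𝓝 (-x)) from hlimU)).add
      (h2.smul (tendsto_const_nhds (x := R x)))
    rw [one_smul, neg_add_eq_sub] at h3
    refine h3.congr' ?_
    filter_upwards [self_mem_nhdsWithin] with t ht
    exact (diffQuot_eq_rescale μ T (R x) ht).symm
  -- The domain asks for bounded quotients on all of `(0, 1]`, not only near `0`.
  obtain ⟨K, hK⟩ := isCompact_Icc.exists_bound_of_continuousOn
    (s := Icc (0 : ℝ) 1) (continuous_scalarExp μ).continuousOn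
  obtain ⟨K', hK'⟩ := isCompact_Icc.exists_bound_of_continuousOn
    (s := Icc (0 : ℝ) 1) (continuous_dslope_scalarExp μ).continuousOn
  have hmem : R x ∈ (generator τ hτ.linear hτ.t2 T).domain := by
    refine ⟨⟨_, hlim⟩, K * (M * ‖x‖) + K' * ‖R x‖, fun t h0 h1 => ?_⟩
    have ht : (t : ℝ) ∈ Icc (0 : ℝ) 1 := ⟨t.coe_nonneg, NNReal.coe_le_one.2 h1⟩
    have hKt := hK _ ht
    have hK0 : 0 ≤ K := (norm_nonneg _).trans hKt
    rw [← norm_diffQuot, diffQuot_eq_rescale μ T (R x) h0]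
    refine (norm_add_le _ _).trans (add_le_add ?_ ?_)
    · rw [norm_smul]
      gcongr
      rw [norm_diffQuot, div_le_iff₀ (NNReal.coe_pos.2 h0)]
      exact hτ.norm_orbitIntegral_sub_le hU hR hε hMU x t
    · rw [norm_smul]
      gcongr
      exact hK' _ ht
  exact ⟨⟨_, hmem⟩, rfl, generator_eq hτ.linear hτ.t2 ⟨_, hmem⟩ hlim⟩

/-- The Laplace transform of a bi-continuous semigroup is the resolvent of its generator. -/
theorem IsStandardTriple.resolvent_eq_laplace (hT : IsBiContinuous τ T) {μ : 𝕜}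
    {R : X →L[𝕜] X} (hR : IsOrbitIntegral τ (rescale μ T) R) {M ω : ℝ} (hω : ω < RCLike.re μ)
    (hM : ∀ t : ℝ≥0, ‖T t‖ ≤ M * Real.exp (ω * t)) :
    μ ∈ resolventSet (generator τ hτ.linear hτ.t2 T) ∧
      resolvent (generator τ hτ.linear hτ.t2 T) μ = R := by
  have hU := hτ.isBiContinuous_rescale hT μ
  refine mem_resolventSet_of_inverse (fun x => ?_) fun y => ?_
  · obtain ⟨C, hC⟩ := x.2.2
    obtain ⟨z, hz, hAz⟩ := hτ.exists_generator_laplace hT hR hω hM (x : X)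
    have h1 := (hτ.isBddSeqContinuous_laplace hT hR hω hM).lim (C := C) (by
      filter_upwards [eventually_mem_Ioc_zero_one] with h hh
      rw [norm_diffQuot]
      exact hC h hh.1 hh.2) (generator_lim hτ.linear hτ.t2 x)
    have h2 := generator_lim hτ.linear hτ.t2 z
    have hcomm : ∀ t : ℝ≥0, R (T t (x : X)) = T t (R x) := fun t => by
      rw [← scalarExp_smul_rescale μ T t (x : X), map_smul, hτ.orbitIntegral_comm hU hR,
        scalarExp_smul_rescale]
    have heq : diffQuot T (z : X) = fun t => R (diffQuot T (x : X) t) := by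
      funext t
      rw [diffQuot, diffQuot, map_smul, map_sub, hcomm, hz]
    rw [heq] at h2
    have h3 := @tendsto_nhds_unique _ _ τ.top hτ.t2 _ _ _ _ _ h1 h2
    rw [map_sub, map_smul, h3, hAz, sub_sub_cancel]
  · obtain ⟨z, hz, hAz⟩ := hτ.exists_generator_laplace hT hR hω hM y
    exact ⟨z, by rw [hAz, hz, sub_sub_cancel]⟩

end BiContinuous

/-! ### The resolvent on the bi-sun dual -/

section Bullet

variable {𝕜 : Type*} [RCLike 𝕜] {X : Type*} [NormedAddCommGroup X] [NormedSpace 𝕜 X]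
  {τ : Topo X} {T : ℝ≥0 → X →L[𝕜] X}

theorem circWeak_lim_iff {ι : Type*} {u : ι → circDual 𝕜 τ} {l : Filter ι} {g : circDual 𝕜 τ} :
    (circWeak τ).Lim u l g ↔
      ∀ x, Tendsto (fun i => (u i : StrongDual 𝕜 X) x) l (𝓝 ((g : StrongDual 𝕜 X) x)) := by
  rw [Topo.Lim, circWeak, nhds_induced, tendsto_comap_iff, tendsto_pi_nhds]
  rfl

/-- By the uniform boundedness principle, the difference quotients of the orbits through the
range of the resolvent are bounded in operator norm. -/
theorem exists_norm_comp_resolvent_sub_le [CompleteSpace X] (hσ : IsVectorTopology 𝕜 τ)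
    (hσ₂ : @T2Space X τ.top) {μ : 𝕜} (hμ : μ ∈ resolventSet (generator τ hσ hσ₂ T)) :
    ∃ C, ∀ t : ℝ≥0, 0 < t → t ≤ 1 → ∀ x,
      ‖diffQuot T (resolvent (generator τ hσ hσ₂ T) μ x) t‖ ≤ C * ‖x‖ := by
  set R := resolvent (generator τ hσ hσ₂ T) μ with hRdef
  let S : {t : ℝ≥0 // 0 < t ∧ t ≤ 1} → X →L[𝕜] X := fun t =>
    (((t.1 : ℝ) : 𝕜)⁻¹) • ((T t.1).comp R - R)
  obtain ⟨C, hC⟩ := banach_steinhaus (g := S) fun x => by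
    obtain ⟨z, hz, -⟩ := exists_resolvent_eq hμ x
    obtain ⟨C, hC⟩ := z.2.2
    refine ⟨C, fun t => ?_⟩
    change ‖diffQuot T (R x) t.1‖ ≤ C
    rw [norm_diffQuot, hRdef, hz]
    exact hC t.1 t.2.1 t.2.2
  exact ⟨C, fun t h0 h1 x => (S ⟨t, h0, h1⟩).le_of_opNorm_le (hC _) x⟩

/-- If the dual of the resolvent `R = R(μ, A)` leaves `X°` invariant, then it maps `X•` into
`D(A•)`: for `f ∈ X•` the functional `g = f ∘ R` satisfies `A° g = μ g - f`, because `T(t)` commutes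
with `R` and `(T(t) R x - R x) / t → A R x = μ R x - x`. -/
theorem range_bulletOp_resolvent_subset [CompleteSpace X] (hσ : IsVectorTopology 𝕜 τ)
    (hσ₂ : @T2Space X τ.top) (hT : IsBiContinuous τ T) {μ : 𝕜}
    (hμ : μ ∈ resolventSet (generator τ hσ hσ₂ T))
    (hR : ∀ f ∈ circDual 𝕜 τ, dualOp (resolvent (generator τ hσ hσ₂ T) μ) f ∈ circDual 𝕜 τ) :
    range (bulletOp hσ hT (resolvent (generator τ hσ hσ₂ T) μ)) ⊆ bulletDomain hσ hT := by
  obtain ⟨C, hC⟩ := exists_norm_comp_resolvent_sub_le hσ hσ₂ hμ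
  rintro _ ⟨f, rfl⟩
  set R := resolvent (generator τ hσ hσ₂ T) μ with hRdef
  let f₀ : circDual 𝕜 τ := f
  let g : circDual 𝕜 τ := ⟨dualOp R f₀, hR _ f₀.2⟩
  have hquot : ∀ t x,
      ((diffQuot (𝕜 := 𝕜) (circSemigroup hσ hT) g t : circDual 𝕜 τ) : StrongDual 𝕜 X) x =
      (f₀ : StrongDual 𝕜 X) (diffQuot T (R x) t) := fun t x => by
    change (((t : ℝ) : 𝕜)⁻¹) • ((f₀ : StrongDual 𝕜 X) (R (T t x)) - (f₀ : StrongDual 𝕜 X) (R x)) =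
      (f₀ : StrongDual 𝕜 X) (diffQuot T (R x) t)
    rw [hRdef, resolvent_generator_comm hσ hσ₂ hT hμ, ← map_sub, ← map_smul]
    rfl
  have hlim : (circWeak τ).Lim (diffQuot (𝕜 := 𝕜) (circSemigroup hσ hT) g) (𝓝[>] 0)
      (μ • g - f₀) := by
    refine circWeak_lim_iff.2 fun x => ?_
    obtain ⟨z, hz, hzx⟩ := exists_resolvent_eq hμ x
    have h := tendsto_of_mem_circDual f₀.2 (C := C * ‖x‖) (by
      filter_upwards [eventually_mem_Ioc_zero_one] with t ht
      exact hC t ht.1 ht.2 x) (by rw [hz]; exact generator_lim hσ hσ₂ z)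
    simp only [hquot]
    convert h using 2
    change μ • (f₀ : StrongDual 𝕜 X) (R x) - (f₀ : StrongDual 𝕜 X) x = _
    rw [hz, ← map_smul, ← map_sub, ← sub_eq_iff_eq_add.2 (sub_eq_iff_eq_add'.1 hzx)]
  have hnorm : ∀ t : ℝ≥0, 0 < t → t ≤ 1 →
      ‖circSemigroup hσ hT t g - g‖ ≤ ‖f₀‖ * |C| * t := fun t h0 h1 => by
    change ‖((circSemigroup hσ hT t g - g : circDual 𝕜 τ) : StrongDual 𝕜 X)‖ ≤ _
    refine ContinuousLinearMap.opNorm_le_bound _ (by positivity) fun x => ?_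
    have h : ((circSemigroup hσ hT t g - g : circDual 𝕜 τ) : StrongDual 𝕜 X) x =
        (f₀ : StrongDual 𝕜 X) (T t (R x) - R x) := by
      rw [map_sub, ← resolvent_generator_comm hσ hσ₂ hT hμ]
      rfl
    have hx := hC t h0 h1 x
    rw [norm_diffQuot, div_le_iff₀ (NNReal.coe_pos.2 h0)] at hx
    rw [h]
    calc ‖(f₀ : StrongDual 𝕜 X) (T t (R x) - R x)‖
        ≤ ‖(f₀ : StrongDual 𝕜 X)‖ * (|C| * ‖x‖ * t) := by
          refine ((f₀ : StrongDual 𝕜 X).le_opNorm _).trans ?_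
          gcongr
          exact hx.trans (by gcongr; exact le_abs_self C)
      _ = ‖f₀‖ * |C| * t * ‖x‖ := by
          rw [Submodule.coe_norm]
          ring
  have hbound : ∀ t : ℝ≥0, 0 < t → t ≤ 1 →
      ‖circSemigroup hσ hT t g - g‖ / t ≤ ‖f₀‖ * |C| := fun t h0 h1 =>
    (div_le_iff₀ (NNReal.coe_pos.2 h0)).2 (hnorm t h0 h1)
  have hdom : g ∈ (circGenerator hσ hT).domain := ⟨⟨_, hlim⟩, _, hbound⟩
  have hval : circGenerator hσ hT ⟨g, hdom⟩ = μ • g - f₀ := generator_eq _ _ _ hlim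
  have hg : g ∈ bullet hσ hT := by
    have hz : Tendsto (fun t : ℝ≥0 => ‖f₀‖ * |C| * (t : ℝ)) (𝓝[>] 0) (𝓝 0) := by
      have := ((NNReal.continuous_coe.tendsto 0).mono_left
        (nhdsWithin_le_nhds (s := Ioi 0))).const_mul (‖f₀‖ * |C|)
      simpa using this
    refine squeeze_zero'
      (Eventually.of_forall fun t => norm_nonneg (circSemigroup hσ hT t g - g)) ?_ hz
    filter_upwards [eventually_mem_Ioc_zero_one] with t ht
    exact hnorm t ht.1 ht.2
  refine ⟨⟨g, hg⟩, ⟨hdom, ?_⟩, rfl⟩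
  rw [hval]
  exact (bullet hσ hT).sub_mem ((bullet hσ hT).smul_mem μ hg) f.2

end Bullet

/-! ### The mixed topology -/

section Mixed

variable {𝕜 : Type*} [RCLike 𝕜] {X : Type*} [NormedAddCommGroup X] [NormedSpace 𝕜 X]
  {τ : Topo X}

theorem isVectorTopology_mixedTopology : IsVectorTopology 𝕜 (mixedTopology 𝕜 τ) := by
  refine ⟨topologicalAddGroup_sInf ?_, continuousSMul_sInf ?_⟩
  · rintro _ ⟨σ, hσ, rfl⟩
    exact hσ.1.addGroup
  · rintro _ ⟨σ, hσ, rfl⟩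
    exact hσ.1.smul

theorem map_val_nhds_induced {Y : Type*} (t : TopologicalSpace Y) {B : Set Y} {x : Y}
    (hx : x ∈ B) :
    map ((↑) : B → Y) (@nhds B (TopologicalSpace.induced (↑) t) ⟨x, hx⟩) = @nhds Y t x ⊓ 𝓟 B := by
  rw [nhds_induced, map_comap, Subtype.range_coe]

/-- On norm bounded sets, neighbourhoods for the mixed topology are neighbourhoods for `τ`. -/
theorem nhds_inf_principal_le_nhds_mixedTopology {B : Set X} (hB : Bornology.IsBounded B) {x : X}
    (hx : x ∈ B) : @nhds X τ.top x ⊓ 𝓟 B ≤ @nhds X (mixedTopology 𝕜 τ).top x := by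
  rw [mixedTopology, nhds_sInf]
  refine le_iInf₂ ?_
  rintro _ ⟨σ, hσ, rfl⟩
  rw [← map_val_nhds_induced _ hx, ← hσ.2.1 B hB, map_val_nhds_induced]
  exact inf_le_left

theorem lim_mixedTopology_of_isBounded {u : ℕ → X} {x : X} (hu : Bornology.IsBounded (range u))
    (hx : τ.Lim u atTop x) : (mixedTopology 𝕜 τ).Lim u atTop x := by
  refine Tendsto.mono_right (tendsto_inf.2 ⟨hx, tendsto_principal.2 ?_⟩)
    (nhds_inf_principal_le_nhds_mixedTopology (hu.insert x) (mem_insert x _))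
  exact Eventually.of_forall fun n => mem_insert_of_mem _ (mem_range_self n)

/-- `p` is `τ`-continuous at the origin on norm bounded sets. -/
def IsMixedSeminorm (τ : Topo X) (p : Seminorm 𝕜 X) : Prop :=
  ∀ k ε : ℝ, 0 < ε → ∃ V ∈ @nhds X τ.top 0, ∀ x ∈ V, ‖x‖ ≤ k → p x < ε

theorem IsContSeminorm.isMixedSeminorm {p : Seminorm 𝕜 X} (hp : IsContSeminorm τ p) :
    IsMixedSeminorm τ p :=
  fun _ ε hε => ⟨{x | p x < ε}, hp.lt_mem_nhds hε, fun _ hx _ => hx⟩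

theorem IsMixedSeminorm.tendsto_sub (hσ : IsVectorTopology 𝕜 τ) {p : Seminorm 𝕜 X}
    (hp : IsMixedSeminorm τ p) {B : Set X} (hB : Bornology.IsBounded B) (b : X) :
    Tendsto (fun y => p (y - b)) (@nhds X τ.top b ⊓ 𝓟 B) (𝓝 0) := by
  obtain ⟨C, hC⟩ := isBounded_iff_forall_norm_le.1 hB
  rw [Metric.tendsto_nhds]
  intro ε hε
  obtain ⟨V, hV, hVp⟩ := hp (C + ‖b‖) ε hε
  have h1 : ∀ᶠ y in @nhds X τ.top b, y - b ∈ V := by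
    let := τ.top
    have := hσ.addGroup
    have h : Tendsto (fun y : X => y - b) (𝓝 b) (𝓝 (b - b)) :=
      (continuous_id.sub continuous_const).tendsto b
    rw [sub_self] at h
    exact h hV
  filter_upwards [h1.filter_mono inf_le_left, mem_inf_of_right (mem_principal_self B)] with y hy hyB
  rw [Real.dist_0_eq_abs, abs_of_nonneg (apply_nonneg p _)]
  exact hVp _ hy ((norm_sub_le _ _).trans (by gcongr; exact hC y hyB))

variable [NormedSpace ℝ X] (hτ : IsStandardTriple 𝕜 τ)
include hτ

theorem IsStandardTriple.mixedTopology_le : (mixedTopology 𝕜 τ).top ≤ τ.top :=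
  sInf_le ⟨τ, ⟨hτ.linear, fun _ _ => rfl, hτ.coarser, le_rfl⟩, rfl⟩

theorem IsStandardTriple.lim_of_lim_mixedTopology {ι : Type*} {u : ι → X} {l : Filter ι} {x : X}
    (h : (mixedTopology 𝕜 τ).Lim u l x) : τ.Lim u l x :=
  h.mono_right (nhds_mono hτ.mixedTopology_le)

variable [IsScalarTower ℝ 𝕜 X]

/-- A seminorm that is `τ`-continuous on norm bounded sets is continuous for the mixed topology:
the topology generated by all such seminorms is a competitor in the definition of the latter. -/
theorem IsStandardTriple.lt_mem_nhds_mixedTopology {p : Seminorm 𝕜 X} (hp : IsMixedSeminorm τ p)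
    {r : ℝ} (hr : 0 < r) : {x | p x < r} ∈ @nhds X (mixedTopology 𝕜 τ).top 0 := by
  let P : SeminormFamily 𝕜 X {p : Seminorm 𝕜 X // IsMixedSeminorm τ p} := fun p => p.1
  let δ : Topo X := ⟨P.moduleFilterBasis.topology⟩
  have hP : @WithSeminorms 𝕜 X _ _ _ _ P δ.top :=
    @WithSeminorms.mk 𝕜 X _ _ _ _ P δ.top rfl
  have hδ : ∀ {α : Type _} (u : α → X) (l : Filter α) (x : X), Tendsto u l (@nhds X δ.top x) ↔
      ∀ p : Seminorm 𝕜 X, IsMixedSeminorm τ p → Tendsto (fun a => p (u a - x)) l (𝓝 0) :=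
    fun u l x => (@tendsto_nhds_iff_seminorm 𝕜 X _ _ _ δ.top _ _ P hP u l x).trans Subtype.forall
  have hnhds : ∀ {B : Set X}, Bornology.IsBounded B → ∀ b,
      @nhds X τ.top b ⊓ 𝓟 B ≤ @nhds X δ.top b := fun {B} hB b =>
    (hδ id _ b).2 fun p hp => hp.tendsto_sub hτ.linear hB b
  have hδτ : δ.top ≤ τ.top := le_of_nhds_le_nhds fun x =>
    hτ.lim_iff.2 fun p hp => (hδ id _ x).1 tendsto_id p hp.isMixedSeminorm
  have hle : (mixedTopology 𝕜 τ).top ≤ δ.top := by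
    refine sInf_le ⟨δ, ⟨⟨?_, ?_⟩, fun B hB => ?_, ?_, hδτ⟩, rfl⟩
    · exact @WithSeminorms.topologicalAddGroup 𝕜 X _ _ _ _ δ.top P hP
    · exact @WithSeminorms.continuousSMul 𝕜 X _ _ _ _ δ.top P hP
    · refine le_antisymm (induced_mono hδτ) (le_of_nhds_le_nhds fun b => ?_)
      rw [@nhds_induced _ _ δ.top, ← map_le_iff_le_comap, map_val_nhds_induced τ.top b.2]
      exact hnhds hB b
    · refine le_of_nhds_le_nhds fun x => le_trans (le_inf (nhds_mono hτ.coarser) ?_)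
        (hnhds (Metric.isBounded_ball (x := x) (r := 1)) x)
      exact le_principal_iff.2 (Metric.ball_mem_nhds x one_pos)
  refine nhds_mono hle ?_
  have h := ((hδ id _ 0).1 tendsto_id p hp).eventually (gt_mem_nhds hr)
  simp only [id, sub_zero] at h
  exact h

/-- The mixed topology is locally convex: it is generated by the seminorms that are `τ`-continuous
on norm bounded sets. A neighbourhood `U` of the origin contains all finite sums `∑ xᵢ` with
`q_i (x_i) < 1`, where `q_i = max (p_i, ‖·‖ / (i + 1))` for suitable `τ`-continuous seminorms `p_i`,
and these sums form a convex set whose gauge is dominated by every `q_i`. -/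
theorem IsStandardTriple.exists_isMixedSeminorm_subset {U : Set X}
    (hU : U ∈ @nhds X (mixedTopology 𝕜 τ).top 0) :
    ∃ p : Seminorm 𝕜 X, IsMixedSeminorm τ p ∧ ∀ x, p x < 1 → x ∈ U := by
  have hhalf : ∀ S : {S : Set X // S ∈ @nhds X (mixedTopology 𝕜 τ).top 0},
      ∃ S' : {S : Set X // S ∈ @nhds X (mixedTopology 𝕜 τ).top 0},
        ∀ v ∈ S'.1, ∀ w ∈ S'.1, v + w ∈ S.1 := fun S => by
    let := (mixedTopology 𝕜 τ).top
    have := (isVectorTopology_mixedTopology (𝕜 := 𝕜) (τ := τ)).addGroup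
    obtain ⟨V, hV, h⟩ := exists_nhds_zero_half S.2
    exact ⟨⟨V, hV⟩, h⟩
  choose half hhalf using hhalf
  -- `S (n + 1) + S (n + 1) ⊆ S n`, so that `S (m + 1) + ⋯ + S (m + n) ⊆ S m`.
  let S : ℕ → {S : Set X // S ∈ @nhds X (mixedTopology 𝕜 τ).top 0} := fun n => half^[n] ⟨U, hU⟩
  have hS : ∀ n, ∀ v ∈ (S (n + 1)).1, ∀ w ∈ (S (n + 1)).1, v + w ∈ (S n).1 := fun n => by
    simp only [S, Function.iterate_succ_apply']
    exact hhalf _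
  have hsum : ∀ (v : ℕ → X) (n m : ℕ), (∀ i, v i ∈ (S (i + 1)).1) →
      ∑ i ∈ Finset.range n, v (m + i) ∈ (S m).1 := by
    intro v n
    induction n with
    | zero =>
      exact fun m _ => by
        simpa using @mem_of_mem_nhds X (mixedTopology 𝕜 τ).top 0 _ (S m).2
    | succ n ih =>
      intro m hv
      rw [Finset.sum_range_succ']
      refine hS m _ ?_ _ (hv m)
      simpa only [add_assoc, add_comm 1] using ih (m + 1) hv
  have hp : ∀ n : ℕ, ∃ p : Seminorm 𝕜 X, IsContSeminorm τ p ∧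
      ∀ x, p x < 1 → ‖x‖ ≤ n + 1 → x ∈ (S (n + 1)).1 := fun n => by
    have h := nhds_inf_principal_le_nhds_mixedTopology (𝕜 := 𝕜) (τ := τ)
      (Metric.isBounded_closedBall (x := (0 : X)) (r := n + 1))
      (Metric.mem_closedBall_self (by positivity)) (S (n + 1)).2
    obtain ⟨p, hp, hpV⟩ := hτ.exists_seminorm_ball_subset (mem_inf_principal.1 h)
    exact ⟨p, hp, fun x hx hn => hpV x hx (by simpa using hn)⟩
  choose p hpc hp using hp
  let q : ℕ → Seminorm 𝕜 X := fun n =>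
    p n ⊔ ((n : ℝ≥0) + 1)⁻¹ • normSeminorm 𝕜 X
  have hq : ∀ n x, q n x = max (p n x) (((n : ℝ) + 1)⁻¹ * ‖x‖) := fun n x => by
    change max (p n x) (((((n : ℝ≥0) + 1)⁻¹ : ℝ≥0) : ℝ) * ‖x‖) = _
    push_cast
    rfl
  have hqS : ∀ n x, q n x < 1 → x ∈ (S (n + 1)).1 := fun n x hx => by
    rw [hq, max_lt_iff, inv_mul_lt_iff₀ (by positivity), mul_one] at hx
    exact hp n x hx.1 hx.2.le
  let W : Set X := convexHull ℝ (⋃ n, (q n).ball 0 1)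
  have hsub : ∀ n, (q n).ball 0 1 ⊆ W := fun n =>
    (subset_iUnion (fun n => (q n).ball 0 1) n).trans (subset_convexHull ℝ _)
  have habs : ∀ n, Absorbent ℝ ((q n).ball 0 1) := fun n =>
    ((q n).restrictScalars ℝ).absorbent_ball_zero one_pos
  have hW0 : (0 : X) ∈ W := hsub 0 (by simp [Seminorm.mem_ball])
  have hWabs : Absorbent ℝ W := (habs 0).mono (hsub 0)
  have hWbal : Balanced 𝕜 W := by
    rintro a ha _ ⟨x, hx, rfl⟩
    have hpre : W ⊆ ((LinearMap.lsmul 𝕜 X a).restrictScalars ℝ) ⁻¹' W :=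
      convexHull_min (iUnion_subset fun n y hy =>
        hsub n ((q n).balanced_ball_zero 1 a ha ⟨y, hy, rfl⟩))
        ((convex_convexHull ℝ _).linear_preimage _)
    exact hpre hx
  -- `Φ '' V` is the set of all finite sums `∑ vₙ` with `q n (vₙ) < 1`.
  have hWU : W ⊆ U := by
    let Φ : (ℕ →₀ X) →ₗ[ℝ] X := Finsupp.lsum ℝ fun _ => LinearMap.id
    let V : Set (ℕ →₀ X) := {v | ∀ n, q n (v n) < 1}
    have hV : Convex ℝ V := by
      have : V = ⋂ n, Finsupp.lapply (R := ℝ) n ⁻¹' ((q n).ball 0 1) := by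
        ext v
        simp [V, Seminorm.mem_ball]
      rw [this]
      exact convex_iInter fun n => ((q n).convex_ball 0 1).linear_preimage _
    have hWΦ : W ⊆ Φ '' V := by
      refine convexHull_min (iUnion_subset fun n x hx => ?_) (hV.linear_image Φ)
      refine ⟨Finsupp.single n x, fun m => ?_, by simp [Φ]⟩
      rw [Finsupp.single_apply]
      split_ifs with h
      · subst h
        simpa [Seminorm.mem_ball] using hx
      · simp
    refine hWΦ.trans ?_
    rintro _ ⟨v, hv, rfl⟩
    have h := hsum v (v.support.sup id).succ 0 fun i => hqS i _ (hv i)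
    have h2 : Φ v = ∑ i ∈ Finset.range (v.support.sup id).succ, v (0 + i) := by
      simp only [zero_add]
      exact Finsupp.sum_of_support_subset v (Finset.subset_range_sup_succ _) _ fun _ _ => rfl
    rw [h2]
    exact h
  let g : Seminorm 𝕜 X := gaugeSeminorm hWbal (convex_convexHull ℝ _) hWabs
  have hg : ∀ n x, g x ≤ q n x := fun n x => by
    refine (gauge_mono (habs n) (hsub n) x).trans_eq ?_
    exact congrFun (((q n).restrictScalars ℝ).gauge_ball) x
  refine ⟨g, fun k ε hε => ?_, fun x hx => hWU (setOfPred_gauge_lt_one_subset_self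
    (convex_convexHull ℝ _) hW0 hWabs hx)⟩
  obtain ⟨n, hn⟩ := exists_nat_gt (k / ε)
  refine ⟨{x | p n x < ε}, (hpc n).lt_mem_nhds hε, fun x hx hk => (hg n x).trans_lt ?_⟩
  rw [hq, max_lt_iff, inv_mul_lt_iff₀ (by positivity)]
  rw [div_lt_iff₀ hε] at hn
  exact ⟨hx, by nlinarith⟩

/-- Sequences that tend to zero in the mixed topology are norm bounded. Otherwise there are
functionals `y_k ∈ (X, τ)'` in the dual unit ball and indices `n_k ≥ k` with
`|y_k (u_{n_k})| > k + 1`, and the seminorm `sup_k |y_k| / (k + 1)` is `τ`-continuous on norm bounded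
sets, hence continuous for the mixed topology. -/
theorem IsStandardTriple.isBounded_range_of_lim_zero {u : ℕ → X}
    (hu : (mixedTopology 𝕜 τ).Lim u atTop 0) : Bornology.IsBounded (range u) := by
  by_contra hnb
  have hbig : ∀ k : ℕ, ∃ n, k ≤ n ∧ (k : ℝ) + 1 < ‖u n‖ := by
    by_contra! hk
    obtain ⟨k, hk⟩ := hk
    refine hnb ?_
    have hfin : Bornology.IsBounded (u '' Finset.range k) :=
      ((Finset.range k).finite_toSet.image u).isBounded
    refine (hfin.union (Metric.isBounded_closedBall (x := (0 : X)) (r := k + 1))).subset ?_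
    rintro _ ⟨n, rfl⟩
    by_cases hn : k ≤ n
    · exact Or.inr (by simpa using hk n hn)
    · exact Or.inl ⟨n, by simpa using hn, rfl⟩
  choose n hn hnu using hbig
  have hy : ∀ k : ℕ, ∃ y : StrongDual 𝕜 X, @Continuous X 𝕜 τ.top _ y ∧ ‖y‖ ≤ 1 ∧
      (k : ℝ) + 1 < ‖y (u (n k))‖ := fun k => by
    obtain ⟨_, ⟨y, hy, hy1, rfl⟩, h⟩ := (lt_isLUB_iff (hτ.norming (u (n k)))).1 (hnu k)
    exact ⟨y, hy, hy1, h⟩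
  choose y hyc hy1 hyu using hy
  let P : ℕ → Seminorm 𝕜 X := fun k =>
    ((k : ℝ≥0) + 1)⁻¹ • (y k).toLinearMap.toSeminorm
  have hP : ∀ k x, P k x = ((k : ℝ) + 1)⁻¹ * ‖y k x‖ := fun k x => by
    change ((((k : ℝ≥0) + 1)⁻¹ : ℝ≥0) : ℝ) * ‖y k x‖ = _
    push_cast
    rfl
  have hyx : ∀ k x, ‖y k x‖ ≤ ‖x‖ := fun k x =>
    ((y k).le_of_opNorm_le (hy1 k) x).trans_eq (one_mul _)
  have hbdd : ∀ x, BddAbove (range fun k => P k x) := fun x => by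
    refine ⟨‖x‖, ?_⟩
    rintro _ ⟨k, rfl⟩
    change P k x ≤ ‖x‖
    rw [hP]
    refine (mul_le_of_le_one_left (norm_nonneg _) (inv_le_one_of_one_le₀ ?_)).trans (hyx k x)
    linarith [(Nat.cast_nonneg k : (0 : ℝ) ≤ k)]
  have happ : ∀ x, (⨆ k, P k) x = ⨆ k, P k x := fun x =>
    Seminorm.iSup_apply (Seminorm.bddAbove_range_iff.2 hbdd)
  have hmix : IsMixedSeminorm τ (⨆ k, P k) := fun K ε hε => by
    obtain ⟨N, hN⟩ := exists_nat_gt (K / (ε / 2))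
    rw [div_lt_iff₀ (by positivity)] at hN
    refine ⟨⋂ k ∈ Finset.range N, {x | ‖y k x‖ < ε / 2}, ?_, fun x hx hxK => ?_⟩
    · refine (Filter.biInter_finset_mem _).2 fun k _ => ?_
      let := τ.top
      have h := ((hyc k).norm.tendsto 0)
      rw [map_zero, norm_zero] at h
      exact h.eventually (gt_mem_nhds (by positivity))
    · rw [happ]
      refine lt_of_le_of_lt (ciSup_le fun k => ?_) (half_lt_self hε)
      rw [hP, inv_mul_le_iff₀ (by positivity)]
      by_cases hk : k < N
      · have h1 : ‖y k x‖ < ε / 2 := by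
          simp only [mem_iInter] at hx
          exact hx k (Finset.mem_range.2 hk)
        nlinarith [(Nat.cast_nonneg k : (0 : ℝ) ≤ k)]
      · have h1 : (N : ℝ) ≤ k := Nat.cast_le.2 (not_lt.1 hk)
        have h2 := (hyx k x).trans hxK
        nlinarith
  have hev : ∀ᶠ m in atTop, (⨆ k, P k) (u m) < 1 :=
    hu (hτ.lt_mem_nhds_mixedTopology hmix one_pos)
  obtain ⟨N, hN⟩ := eventually_atTop.1 hev
  have h1 := hN (n N) (hn N)
  rw [happ] at h1
  have h2 := (le_ciSup (hbdd (u (n N))) N).trans_lt h1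
  rw [hP, inv_mul_lt_iff₀ (by positivity), mul_one] at h2
  exact absurd h2 (hyu N).not_gt

theorem IsStandardTriple.isBounded_range_of_lim {u : ℕ → X} {x : X}
    (hu : (mixedTopology 𝕜 τ).Lim u atTop x) : Bornology.IsBounded (range u) := by
  have h0 : (mixedTopology 𝕜 τ).Lim (fun n => u n - x) atTop 0 := by
    let := (mixedTopology 𝕜 τ).top
    have := (isVectorTopology_mixedTopology (𝕜 := 𝕜) (τ := τ)).addGroup
    change Tendsto _ _ (𝓝 0)
    rw [← sub_self x]
    exact Tendsto.sub hu tendsto_const_nhds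
  obtain ⟨C, hC⟩ := isBounded_iff_forall_norm_le.1 (hτ.isBounded_range_of_lim_zero h0)
  refine isBounded_iff_forall_norm_le.2 ⟨C + ‖x‖, ?_⟩
  rintro _ ⟨n, rfl⟩
  calc ‖u n‖ = ‖(u n - x) + x‖ := by rw [sub_add_cancel]
    _ ≤ C + ‖x‖ := (norm_add_le _ _).trans (by gcongr; exact hC _ (mem_range_self n))

end Mixed

/-! ### Equicontinuity of the resolvents in the mixed topology -/

section Equicontinuity

variable {𝕜 : Type*} [RCLike 𝕜] {X : Type*} [NormedAddCommGroup X] [NormedSpace 𝕜 X]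
  {τ : Topo X} {T : ℝ≥0 → X →L[𝕜] X}

theorem IsEquicontinuousFamily.continuous {σ : Topo X} (hσ : IsVectorTopology 𝕜 σ)
    {F : Set (X →L[𝕜] X)} (hF : IsEquicontinuousFamily σ F) {S : X →L[𝕜] X} (hS : S ∈ F) :
    @Continuous X X σ.top σ.top S := by
  let S' : X →+ X := S.toLinearMap.toAddMonoidHom
  let := σ.top
  have := hσ.addGroup
  refine continuous_of_continuousAt_zero S' ?_
  intro U hU
  have hU' : U ∈ 𝓝 (0 : X) := by rwa [map_zero] at hU
  obtain ⟨V, hV, h⟩ := hF U hU'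
  exact mem_map.2 (mem_of_superset hV fun x hx => h S hS x hx)

variable [NormedSpace ℝ X] (hτ : IsStandardTriple 𝕜 τ)
include hτ

/-- An operator that is continuous for the mixed topology is `τ`-sequentially continuous on norm
bounded sets. -/
theorem IsStandardTriple.isBddSeqContinuous_of_continuous {S : X →L[𝕜] X}
    (hS : @Continuous X X (mixedTopology 𝕜 τ).top (mixedTopology 𝕜 τ).top S) :
    IsBddSeqContinuous τ S := by
  intro u x hu hx
  refine hτ.lim_of_lim_mixedTopology ?_
  have h := lim_mixedTopology_of_isBounded (𝕜 := 𝕜) hu hx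
  let := (mixedTopology 𝕜 τ).top
  exact (hS.tendsto x).comp h

/-- Laplace transforms are bounded uniformly on `re μ ≥ α`. -/
theorem IsStandardTriple.norm_laplace_le {μ : 𝕜} {R : X →L[𝕜] X}
    (hR : IsOrbitIntegral τ (rescale μ T) R) {M ω α : ℝ} (hωα : ω < α) (hα : α ≤ RCLike.re μ)
    (hM : ∀ t : ℝ≥0, ‖T t‖ ≤ M * Real.exp (ω * t)) (x : X) :
    ‖R x‖ ≤ M * ‖x‖ * ∫ s in Ioi (0 : ℝ), Real.exp (-(α - ω) * s) := by
  have hM0 : 0 ≤ M := by simpa using (norm_nonneg _).trans (hM 0)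
  rw [← integral_const_mul]
  refine hτ.norm_le_integral (hR x)
    ((exp_neg_integrableOn_Ioi 0 (sub_pos.2 hωα)).const_mul (M * ‖x‖)) ?_
  filter_upwards [ae_restrict_mem measurableSet_Ioi] with s hs
  have hs' : (0 : ℝ) < s := hs
  refine (norm_orbit_le (norm_rescale_le μ hM) x hs'.le).trans ?_
  gcongr

variable [IsScalarTower ℝ 𝕜 X]

/-- Along a null sequence of the mixed topology, the resolvents tend to zero in the mixed topology,
uniformly on `re μ ≥ α`. -/
theorem IsStandardTriple.eventually_seminorm_laplace_lt (hT : IsBiContinuous τ T)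
    {R : 𝕜 → X →L[𝕜] X} {M ω α : ℝ} (hωα : ω < α)
    (hR : ∀ μ : 𝕜, α ≤ RCLike.re μ → IsOrbitIntegral τ (rescale μ T) (R μ))
    (hM : ∀ t : ℝ≥0, ‖T t‖ ≤ M * Real.exp (ω * t)) {p : Seminorm 𝕜 X} (hp : IsMixedSeminorm τ p)
    {u : ℕ → X} {x : X} (hu : (mixedTopology 𝕜 τ).Lim u atTop x) {ε : ℝ} (hε : 0 < ε) :
    ∀ᶠ n in atTop, ∀ μ : 𝕜, α ≤ RCLike.re μ → p (R μ (u n - x)) < ε := by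
  have hbdd := hτ.isBounded_range_of_lim hu
  obtain ⟨C, hC⟩ := isBounded_iff_forall_norm_le.1 hbdd
  have hM0 : 0 ≤ M := by simpa using (norm_nonneg _).trans (hM 0)
  have hI : 0 ≤ ∫ s in Ioi (0 : ℝ), Real.exp (-(α - ω) * s) :=
    integral_nonneg fun s => (Real.exp_pos _).le
  obtain ⟨V, hV, hVp⟩ :=
    hp (M * (C + ‖x‖) * ∫ s in Ioi (0 : ℝ), Real.exp (-(α - ω) * s)) ε hε
  obtain ⟨r, hr, hrV⟩ := hτ.exists_seminorm_ball_subset hV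
  have hlim := hτ.tendsto_integral_seminorm_orbit hT hωα hM hr hbdd
    (hτ.lim_of_lim_mixedTopology hu)
  filter_upwards [hlim.eventually (gt_mem_nhds one_pos)] with n hn μ hμ
  refine hVp _ (hrV _ ((hτ.seminorm_laplace_le hT (hR μ hμ) hωα hμ hM hr _).trans_lt hn)) ?_
  refine (hτ.norm_laplace_le (hR μ hμ) hωα hμ hM _).trans ?_
  gcongr
  exact (norm_sub_le _ _).trans (by gcongr; exact hC _ (mem_range_self n))

/-- In a C-sequential mixed topology the resolvents on `re μ ≥ α` are equicontinuous: the set of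
all `x` such that `p (R(μ, A) x)` stays uniformly below `1` is convex and sequentially open. -/
theorem IsStandardTriple.isEquicontinuousFamily_laplace (hT : IsBiContinuous τ T)
    (hγ : IsCSequential (mixedTopology 𝕜 τ)) {R : 𝕜 → X →L[𝕜] X} {M ω α : ℝ} (hωα : ω < α)
    (hR : ∀ μ : 𝕜, α ≤ RCLike.re μ → IsOrbitIntegral τ (rescale μ T) (R μ))
    (hM : ∀ t : ℝ≥0, ‖T t‖ ≤ M * Real.exp (ω * t)) :
    IsEquicontinuousFamily (mixedTopology 𝕜 τ) {S | ∃ μ : 𝕜, α ≤ RCLike.re μ ∧ S = R μ} := by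
  intro U hU
  obtain ⟨p, hp, hpU⟩ := hτ.exists_isMixedSeminorm_subset hU
  let V : Set X := {x | ∃ r < 1, ∀ μ : 𝕜, α ≤ RCLike.re μ → p (R μ x) ≤ r}
  have hconv : Convex ℝ V := by
    rintro x ⟨r, hr, hx⟩ y ⟨s, hs, hy⟩ a b ha hb hab
    refine ⟨a * r + b * s, ?_, fun μ hμ => ?_⟩
    · calc a * r + b * s ≤ a * max r s + b * max r s := by
            gcongr
            · exact le_max_left r s
            · exact le_max_right r s
        _ = max r s := by rw [← add_mul, hab, one_mul]
        _ < 1 := max_lt hr hs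
    · have h : ∀ (c : ℝ) (z : X), 0 ≤ c → p (R μ (c • z)) = c * p (R μ z) := fun c z hc => by
        rw [← algebraMap_smul 𝕜 c z, map_smul, map_smul_eq_mul, norm_algebraMap',
          Real.norm_of_nonneg hc]
      rw [map_add]
      refine (map_add_le_add p _ _).trans ?_
      rw [h a x ha, h b y hb]
      gcongr
      · exact hx μ hμ
      · exact hy μ hμ
  have hopen : @IsOpen X (mixedTopology 𝕜 τ).top V := by
    refine hγ V hconv ?_
    rintro u x ⟨r, hr, hx⟩ hu
    have hε : 0 < (1 - r) / 2 := by linarith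
    filter_upwards [hτ.eventually_seminorm_laplace_lt hT hωα hR hM hp hu hε] with n hn
    refine ⟨(1 + r) / 2, by linarith, fun μ hμ => ?_⟩
    have h := map_add_le_add p (R μ (u n - x)) (R μ x)
    rw [← map_add, sub_add_cancel] at h
    linarith [hn μ hμ, hx μ hμ]
  refine ⟨V, @IsOpen.mem_nhds X (mixedTopology 𝕜 τ).top 0 V hopen
    ⟨0, one_pos, fun μ _ => by simp⟩, ?_⟩
  rintro _ ⟨μ, hμ, rfl⟩ x ⟨r, hr, hx⟩
  exact hpU _ ((hx μ hμ).trans_lt hr)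

end Equicontinuity
end BiSun

theorem mainTheorem5 {𝕜 : Type*} [RCLike 𝕜] {X : Type*} [NormedAddCommGroup X]
    [NormedSpace 𝕜 X] [NormedSpace ℝ X] [IsScalarTower ℝ 𝕜 X] [CompleteSpace X]
    (τ : BiSun.Topo X) (hτ : BiSun.IsStandardTriple 𝕜 τ) (hd : BiSun.IsDualAdmissible 𝕜 τ)
    (γ : BiSun.Topo X) (hγ : γ = BiSun.mixedTopology 𝕜 τ)
    (T : ℝ≥0 → X →L[𝕜] X) (hT : BiSun.IsBiContinuous τ T)
    (A : X →ₗ.[𝕜] X) (hA : A = BiSun.generator τ hτ.linear hτ.t2 T) :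
    (∀ μ : 𝕜, BiSun.growthBound T < ((RCLike.re μ : ℝ) : EReal) →
      μ ∈ BiSun.resolventSet A ∧
      Set.range (BiSun.bulletOp hτ.linear hT (BiSun.resolvent A μ)) ⊆
        BiSun.bulletDomain hτ.linear hT) ∧
    (BiSun.IsMazur 𝕜 γ → ∀ μ ∈ BiSun.resolventSet A,
      @Continuous X X γ.top γ.top (BiSun.resolvent A μ) →
      Set.range (BiSun.bulletOp hτ.linear hT (BiSun.resolvent A μ)) ⊆
        BiSun.bulletDomain hτ.linear hT) ∧
    (BiSun.IsCSequential γ →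
      (∀ α : ℝ, BiSun.growthBound T < (α : EReal) →
        BiSun.IsEquicontinuousFamily γ
          {R | ∃ μ : 𝕜, α ≤ RCLike.re μ ∧ R = BiSun.resolvent A μ}) ∧
      (∀ μ : 𝕜, BiSun.growthBound T < ((RCLike.re μ : ℝ) : EReal) →
        @Continuous X X γ.top γ.top (BiSun.resolvent A μ))) := by
  subst hγ hA
  have key : ∀ (α : ℝ), BiSun.growthBound T < (α : EReal) → ∃ ω < α, ∃ M : ℝ,
      (∀ t : ℝ≥0, ‖T t‖ ≤ M * Real.exp (ω * t)) ∧ ∀ μ : 𝕜, α ≤ RCLike.re μ →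
        μ ∈ BiSun.resolventSet (BiSun.generator τ hτ.linear hτ.t2 T) ∧
        BiSun.IsOrbitIntegral τ (BiSun.rescale μ T)
          (BiSun.resolvent (BiSun.generator τ hτ.linear hτ.t2 T) μ) := by
    intro α hα
    obtain ⟨ω, hω, M, hM⟩ := BiSun.exists_lt_of_growthBound_lt hα
    refine ⟨ω, hω, M, hM, fun μ hμ => ?_⟩
    have hωμ := hω.trans_le hμ
    obtain ⟨R, hR⟩ := hτ.exists_isOrbitIntegral (hτ.isBiContinuous_rescale hT μ)
      (sub_pos.2 hωμ) (BiSun.norm_rescale_le μ hM)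
    obtain ⟨hρ, hres⟩ := hτ.resolvent_eq_laplace hT hR hωμ hM
    exact ⟨hρ, hres ▸ hR⟩
  refine ⟨fun μ hμ => ?_, fun _ μ hμ hc => ?_, fun hC => ?_⟩
  · obtain ⟨ω, hω, M, hM, h⟩ := key _ hμ
    obtain ⟨hρ, hR⟩ := h μ le_rfl
    exact ⟨hρ, BiSun.range_bulletOp_resolvent_subset hτ.linear hτ.t2 hT hρ fun f hf =>
      (hτ.isBddSeqContinuous_laplace hT hR hω hM).dualOp_mem hf⟩
  · exact BiSun.range_bulletOp_resolvent_subset hτ.linear hτ.t2 hT hμ fun f hf =>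
      (hτ.isBddSeqContinuous_of_continuous hc).dualOp_mem hf
  · have hequi : ∀ α : ℝ, BiSun.growthBound T < (α : EReal) →
        BiSun.IsEquicontinuousFamily (BiSun.mixedTopology 𝕜 τ)
          {R | ∃ μ : 𝕜, α ≤ RCLike.re μ ∧
            R = BiSun.resolvent (BiSun.generator τ hτ.linear hτ.t2 T) μ} := by
      intro α hα
      obtain ⟨ω, hω, M, hM, h⟩ := key α hα
      exact hτ.isEquicontinuousFamily_laplace hT hC hω (fun μ hμ => (h μ hμ).2) hM
    exact ⟨hequi, fun μ hμ => (hequi _ hμ).continuous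
      BiSun.isVectorTopology_mixedTopology ⟨μ, le_rfl, rfl⟩⟩
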